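/- Fix integers $2\le r_1<r_2$. For each $n\ge 1$ let $V_n$ be a finite set, let $H_n^{(1)}$ be an $r_1$-uniform hypergraph and $H_n^{(2)}$ an $r_2$-uniform hypergraph, both with vertex set $V_n$ (an $r$-uniform hypergraph has as hyperedges a set $E(H)$ of $r$-element subsets of its vertex set). Let $(c_n)$ be a sequence of positive integers with $c_n\to\infty$, and color the vertices in $V_n$ independently and uniformly at random with $c_n$ colors: the color $X_v$ of each $v\in V_n$ equals each $a\in\{1,\dots,c_n\}$ with probability $1/c_n$, independently of the other vertices. For $i\in\{1,2\}$ let $$T(H_n^{(i)})=\sum_{e\in E(H_n^{(i)})}\mathbf 1\{X_v=X_{v'}\text{ for all }v,v'\in e\}$$ be the number of monochromatic hyperedges of $H_n^{(i)}$ (the same coloring being used for $i=1$ and $i=2$). Suppose that there are constants $\lambda_1,\lambda_2\ge 0$ such that, for each $i\in\{1,2\}$, $$\lim_{n\to\infty}\mathbb E[T(H_n^{(i)})]=\lim_{n\to\infty}\operatorname{Var}[T(H_n^{(i)})]=\lambda_i .$$ Then, as $n\to\infty$, $$\bigl(T(H_n^{(1)}),T(H_n^{(2)})\bigr)\ \xrightarrow{D}\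 (Z_1,Z_2),$$ where $Z_1\sim\mathrm{Pois}(\lambda_1)$ and $Z_2\sim\mathrm{Pois}(\lambda_2)$ are independent, and $\mathrm{Pois}(0)$ is the point mass at $0$. -/

import Mathlib

open MeasureTheory ProbabilityTheory Filter
open scoped NNReal

/-- A hypergraph is `r`-uniform if every hyperedge has exactly `r` vertices. -/
def Hypergraph.IsUniform {V : Type*} (H : Hypergraph V) (r : ℕ) : Prop :=
  ∀ e ∈ H.edgeSet, e.encard = r

/-- A set `e` of vertices is monochromatic for the coloring `x` if all its vertices have the same
color. -/
def IsMonochromatic {V C : Type*} (x : V → C) (e : Set V) : Prop :=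
  ∀ v ∈ e, ∀ w ∈ e, x v = x w

/-- `H.monoCount x`: the number of hyperedges of `H` that are monochromatic for the vertex
coloring `x` (on a finite vertex type this is the sum over the hyperedges of the indicators). -/
noncomputable def Hypergraph.monoCount {V C : Type*} (H : Hypergraph V) (x : V → C) : ℕ :=
  {e | e ∈ H.edgeSet ∧ IsMonochromatic x e}.ncard

/-- `X` is a uniformly random coloring of the vertices `V` with `c` colors, on the probability
space `(Ω, P)`: the colors of distinct vertices are independent, and each vertex has each color
with probability `1 / c`. -/
structure IsUniformColoring {V Ω : Type*} [MeasurableSpace Ω] (P : Measure Ω) (c : ℕ)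
    (X : V → Ω → Fin c) : Prop where
  measurable : ∀ v, Measurable (X v)
  indep : iIndepFun X P
  uniform : ∀ v a, P.real {ω | X v ω = a} = 1 / (c : ℝ)

namespace HypergraphColoring

section Average

open Finset
open scoped BigOperators

variable {V C : Type*}

/-- A function does not depend on the color of `v`. -/
def IgnoresColor [DecidableEq V] {M : Type*} (v : V) (g : (V → C) → M) : Prop :=
  ∀ x a, g (Function.update x v a) = g x

open Classical in
/-- The indicator that `S` is monochromatic. -/
noncomputable def monoInd (S : Finset V) (x : V → C) : ℝ :=
  if ∀ v ∈ S, ∀ w ∈ S, x v = x w then 1 else 0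

lemma monoInd_eq_zero_or_one (S : Finset V) (x : V → C) : monoInd S x = 0 ∨ monoInd S x = 1 := by
  unfold monoInd; split_ifs <;> simp

lemma monoInd_nonneg (S : Finset V) (x : V → C) : 0 ≤ monoInd S x := by
  rcases monoInd_eq_zero_or_one S x with h | h <;> simp [h]

lemma monoInd_singleton (s : V) (x : V → C) : monoInd {s} x = 1 := by
  simp [monoInd]

lemma monoInd_mul_self (S : Finset V) (x : V → C) : monoInd S x * monoInd S x = monoInd S x := by
  rcases monoInd_eq_zero_or_one S x with h | h <;> simp [h]

lemma monoInd_ignoresColor [DecidableEq V] {S : Finset V} {v : V} (hv : v ∉ S) :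
    IgnoresColor v (monoInd (C := C) S) := by
  intro x a
  have h : ∀ u ∈ S, Function.update x v a u = x u := fun u hu =>
    Function.update_of_ne (fun h => hv (by rwa [← h])) _ _
  unfold monoInd
  congr 1
  exact propext ⟨fun H u hu w hw => by rw [← h u hu, ← h w hw]; exact H u hu w hw,
    fun H u hu w hw => by rw [h u hu, h w hw]; exact H u hu w hw⟩

/-- Overlapping monochromatic sets have a monochromatic union. -/
lemma monoInd_mul_of_inter_nonempty [DecidableEq V] {S T : Finset V} (h : (S ∩ T).Nonempty)
    (x : V → C) : monoInd S x * monoInd T x = monoInd (S ∪ T) x := by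
  obtain ⟨z, hz⟩ := h
  obtain ⟨hzS, hzT⟩ := mem_inter.1 hz
  unfold monoInd
  by_cases hS : ∀ v ∈ S, ∀ w ∈ S, x v = x w
  · by_cases hT : ∀ v ∈ T, ∀ w ∈ T, x v = x w
    · have : ∀ v ∈ S ∪ T, x v = x z := by
        intro v hv
        rcases mem_union.1 hv with hv | hv
        · exact hS v hv z hzS
        · exact hT v hv z hzT
      rw [if_pos hS, if_pos hT, if_pos, one_mul]
      intro v hv w hw
      rw [this v hv, this w hw]
    · rw [if_neg hT, mul_zero, if_neg]
      exact fun (H : ∀ v ∈ S ∪ T, ∀ w ∈ S ∪ T, x v = x w) => hT fun v hv w hw => H v (mem_union_right _ hv) w (mem_union_right _ hw)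
  · rw [if_neg hS, zero_mul, if_neg]
    exact fun (H : ∀ v ∈ S ∪ T, ∀ w ∈ S ∪ T, x v = x w) => hS fun v hv w hw => H v (mem_union_left _ hv) w (mem_union_left _ hw)

variable [Fintype C]

variable (C) in
/-- The probability that two given vertices have the same color. -/
noncomputable def invCard : ℝ := (Fintype.card C : ℝ)⁻¹

lemma invCard_nonneg : 0 ≤ invCard C := by unfold invCard; positivity

lemma invCard_pos [Nonempty C] : 0 < invCard C := by
  unfold invCard
  have : 0 < Fintype.card C := Fintype.card_pos
  positivity

lemma invCard_le_one : invCard C ≤ 1 := by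
  unfold invCard
  exact Nat.cast_inv_le_one _

variable [DecidableEq V]

variable (C) in
/-- The probability that two distinct sets sharing at least two vertices are both monochromatic;
`0` for all other pairs. -/
noncomputable def overlapWeight (e f : Finset V) : ℝ :=
  if e ≠ f ∧ 2 ≤ (e ∩ f).card then invCard C ^ ((e ∪ f).card - 1) else 0

variable (C) in
/-- The total overlap weight of ordered pairs of members of `E` and `F`. -/
noncomputable def overlap (E F : Finset (Finset V)) : ℝ :=
  ∑ e ∈ E, ∑ f ∈ F, overlapWeight C e f

lemma overlapWeight_nonneg (e f : Finset V) : 0 ≤ overlapWeight C e f := by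
  unfold overlapWeight
  split_ifs
  · exact pow_nonneg invCard_nonneg _
  · exact le_rfl

lemma overlapWeight_comm (e f : Finset V) : overlapWeight C e f = overlapWeight C f e := by
  unfold overlapWeight
  simp only [ne_comm (a := e), inter_comm e, union_comm e]

lemma overlap_nonneg (E F : Finset (Finset V)) : 0 ≤ overlap C E F :=
  sum_nonneg fun _ _ => sum_nonneg fun _ _ => overlapWeight_nonneg _ _

variable (C) in
/-- The expected number of monochromatic members of `E`. -/
noncomputable def meanCount (E : Finset (Finset V)) : ℝ :=
  ∑ e ∈ E, invCard C ^ (e.card - 1)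

lemma expect_monoInd_insert_update {S : Finset V} (hS : S.Nonempty) {k : V}
    (hk : k ∉ S) (x : V → C) :
    𝔼 a, monoInd (insert k S) (Function.update x k a) = invCard C * monoInd S x := by
  classical
  obtain ⟨s, hs⟩ := hS
  have hsk : s ≠ k := fun h => hk (h ▸ hs)
  have : ∀ a, monoInd (insert k S) (Function.update x k a)
      = (if x s = a then 1 else 0) * monoInd S x := by
    intro a
    have h1 : insert k S = {k, s} ∪ S := by
      ext u; simp only [mem_insert, mem_union, mem_singleton]
      constructor
      · rintro (h | h) <;> simp [h]
      · rintro ((h | h) | h) <;> simp [h, hs]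
    rw [h1, ← monoInd_mul_of_inter_nonempty ⟨s, by simp [hs]⟩, monoInd_ignoresColor hk]
    congr 1
    have h2 : (∀ v ∈ ({k, s} : Finset V), ∀ w ∈ ({k, s} : Finset V),
        Function.update x k a v = Function.update x k a w) ↔ x s = a := by
      have hs' : Function.update x k a s = x s := Function.update_of_ne hsk _ _
      simp only [mem_insert, mem_singleton, forall_eq_or_imp, forall_eq, Function.update_self, hs']
      grind
    unfold monoInd
    simp only [h2]
  simp_rw [this, ← expect_mul]
  congr 1
  rw [Fintype.expect_eq_sum_div_card]
  simp [invCard]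

variable [Fintype V]

/-- Resampling one coordinate does not change the average over all colorings. -/
lemma expect_update [Nonempty C] {M : Type*} [AddCommGroup M] [Module ℚ≥0 M]
    (k : V) (f : (V → C) → M) :
    𝔼 x, 𝔼 a, f (Function.update x k a) = 𝔼 x, f x := by
  rw [← expect_product' univ univ (fun x a => f (Function.update x k a))]
  have h : 𝔼 y ∈ univ ×ˢ (univ : Finset C), f y.1 = 𝔼 x, f x := by
    rw [expect_product]
    simp
  rw [← h]
  refine expect_nbij' (fun y => (Function.update y.1 k y.2, y.1 k))
    (fun y => (Function.update y.1 k y.2, y.1 k)) ?_ ?_ ?_ ?_ ?_ <;> simp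

lemma expect_monoInd_mul [Nonempty C] {g : (V → C) → ℝ} (s : V) (S : Finset V)
    (hs : s ∉ S) (hg : ∀ v ∈ S, IgnoresColor v g) :
    𝔼 x, monoInd (insert s S) x * g x = invCard C ^ S.card * 𝔼 x, g x := by
  induction S using Finset.induction_on with
  | empty => simp [monoInd_singleton]
  | insert k S hk ih =>
    have hsk : k ≠ s := fun h => hs (h ▸ mem_insert_self k S)
    have hk' : k ∉ insert s S := by simp [hsk, hk]
    rw [Finset.insert_comm, ← expect_update k]
    have : ∀ x : V → C, 𝔼 a, monoInd (insert k (insert s S)) (Function.update x k a)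
        * g (Function.update x k a) = invCard C * (monoInd (insert s S) x * g x) := by
      intro x
      simp_rw [hg k (mem_insert_self _ _) x, ← expect_mul,
        expect_monoInd_insert_update (insert_nonempty s S) hk', mul_assoc]
    simp_rw [this, ← mul_expect]
    rw [ih (fun h => hs (mem_insert_of_mem h)) (fun v hv => hg v (mem_insert_of_mem hv)),
      card_insert_of_notMem hk, pow_succ]
    ring

variable [Nonempty C]

lemma expect_monoInd {S : Finset V} (hS : S.Nonempty) :
    𝔼 x : V → C, monoInd S x = invCard C ^ (S.card - 1) := by
  obtain ⟨s, hs⟩ := hS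
  have := expect_monoInd_mul (C := C) (g := fun _ => 1) s (S.erase s) (notMem_erase _ _)
    (fun _ _ _ _ => rfl)
  simpa [insert_erase hs, card_erase_of_mem hs] using this

lemma expect_monoInd_mul_monoInd_of_card_inter_le_one {S T : Finset V} (hS : S.Nonempty)
    (hT : T.Nonempty) (h : (S ∩ T).card ≤ 1) :
    𝔼 x : V → C, monoInd S x * monoInd T x
      = invCard C ^ (S.card - 1) * invCard C ^ (T.card - 1) := by
  obtain ⟨s, hs, hsT⟩ : ∃ s ∈ S, ∀ v ∈ S.erase s, v ∉ T := by
    rcases (S ∩ T).eq_empty_or_nonempty with h0 | ⟨s, hs⟩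
    · obtain ⟨s, hs⟩ := hS
      refine ⟨s, hs, fun v hv hvT => ?_⟩
      have : v ∈ S ∩ T := mem_inter.2 ⟨mem_of_mem_erase hv, hvT⟩
      simp [h0] at this
    · refine ⟨s, (mem_inter.1 hs).1, fun v hv hvT => ?_⟩
      exact (mem_erase.1 hv).1 (card_le_one.1 h v (mem_inter.2 ⟨mem_of_mem_erase hv, hvT⟩) s hs)
  have := expect_monoInd_mul (C := C) (g := monoInd T) s (S.erase s) (notMem_erase _ _)
    (fun v hv => monoInd_ignoresColor (hsT v hv))
  rw [insert_erase hs, card_erase_of_mem hs, expect_monoInd hT] at this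
  exact this

lemma expect_monoInd_mul_monoInd_of_inter_nonempty {S T : Finset V} (h : (S ∩ T).Nonempty) :
    𝔼 x : V → C, monoInd S x * monoInd T x = invCard C ^ ((S ∪ T).card - 1) := by
  simp_rw [monoInd_mul_of_inter_nonempty h]
  exact expect_monoInd (h.mono (inter_subset_left.trans subset_union_left))

end Average

section Order

open Finset
open scoped BigOperators

variable {V C : Type*} [LinearOrder V]

/-- The members of `E` whose largest vertex is `k`. -/
def lastAt (E : Finset (Finset V)) (k : V) : Finset (Finset V) :=
  E.filter fun e => k ∈ e ∧ ∀ u ∈ e, u ≤ k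

/-- The set `e` without its largest vertex. -/
def initSeg (e : Finset V) : Finset V := e.filter fun v => ∃ u ∈ e, v < u

lemma mem_lastAt {E : Finset (Finset V)} {k : V} {e : Finset V} :
    e ∈ lastAt E k ↔ e ∈ E ∧ k ∈ e ∧ ∀ u ∈ e, u ≤ k := by
  simp [lastAt]

lemma lastAt_subset (E : Finset (Finset V)) (k : V) : lastAt E k ⊆ E := filter_subset _ _

lemma initSeg_subset (e : Finset V) : initSeg e ⊆ e := filter_subset _ _

lemma initSeg_eq_erase {e : Finset V} {k : V} (hk : k ∈ e) (h : ∀ u ∈ e, u ≤ k) :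
    initSeg e = e.erase k := by
  ext v
  simp only [initSeg, mem_filter, mem_erase]
  constructor
  · rintro ⟨hv, u, hu, hvu⟩
    exact ⟨(hvu.trans_le (h u hu)).ne, hv⟩
  · rintro ⟨hne, hv⟩
    exact ⟨hv, k, hk, lt_of_le_of_ne (h v hv) hne⟩

lemma exists_last {e : Finset V} (he : e.Nonempty) : ∃ k ∈ e, ∀ u ∈ e, u ≤ k :=
  ⟨e.max' he, e.max'_mem he, fun u hu => e.le_max' u hu⟩

lemma card_initSeg {e : Finset V} (he : e.Nonempty) : (initSeg e).card + 1 = e.card := by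
  obtain ⟨k, hk, h⟩ := exists_last he
  rw [initSeg_eq_erase hk h, card_erase_add_one hk]

lemma initSeg_nonempty {e : Finset V} (he : 2 ≤ e.card) : (initSeg e).Nonempty := by
  have := card_initSeg (card_pos.1 (by omega : 0 < e.card))
  exact card_pos.1 (by omega)

lemma card_union_le_initSeg {e f : Finset V} (he : e.Nonempty) (hf : f.Nonempty) :
    (e ∪ f).card ≤ (initSeg e ∪ initSeg f).card + 2 := by
  obtain ⟨k, hk, h⟩ := exists_last he
  obtain ⟨l, hl, h'⟩ := exists_last hf
  rw [initSeg_eq_erase hk h, initSeg_eq_erase hl h']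
  have : e ∪ f ⊆ insert k (insert l (e.erase k ∪ f.erase l)) := by
    intro v hv
    simp only [mem_union, mem_insert, mem_erase] at hv ⊢
    tauto
  refine (card_le_card this).trans ((card_insert_le _ _).trans ?_)
  have := card_insert_le l (e.erase k ∪ f.erase l)
  omega

@[to_additive]
lemma prod_prod_lastAt [Fintype V] {M : Type*} [CommMonoid M] {E : Finset (Finset V)}
    (hE : ∀ e ∈ E, e.Nonempty) (g : Finset V → M) :
    ∏ k, ∏ e ∈ lastAt E k, g e = ∏ e ∈ E, g e := by
  simp_rw [lastAt, prod_filter]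
  rw [Finset.prod_comm]
  refine prod_congr rfl fun e he => ?_
  obtain ⟨k, hk, h⟩ := exists_last (hE e he)
  rw [Fintype.prod_eq_single k, if_pos ⟨hk, h⟩]
  rintro l hl
  rw [if_neg]
  rintro ⟨hle, h'⟩
  exact hl (le_antisymm (h l hle) (h' k hk))

variable [Fintype V] [Fintype C] [Nonempty C]

lemma expect_monoInd_initSeg {e : Finset V} (he : 2 ≤ e.card) :
    𝔼 x : V → C, invCard C * monoInd (initSeg e) x = invCard C ^ (e.card - 1) := by
  have h := card_initSeg (card_pos.1 (by omega : 0 < e.card))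
  have h' := (initSeg_nonempty he).card_pos
  rw [← mul_expect, expect_monoInd (initSeg_nonempty he), ← pow_succ']
  congr 1
  omega

lemma abs_covariance_initSeg_le {e f : Finset V} (he : 2 ≤ e.card) (hf : 2 ≤ f.card) :
    |𝔼 x : V → C, (invCard C * monoInd (initSeg e) x) * (invCard C * monoInd (initSeg f) x)
        - invCard C ^ (e.card - 1) * invCard C ^ (f.card - 1)|
      ≤ overlapWeight C e f + if e = f then invCard C * invCard C ^ (e.card - 1) else 0 := by
  have he0 : e.Nonempty := card_pos.1 (by omega)
  have hf0 : f.Nonempty := card_pos.1 (by omega)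
  have h1 := card_initSeg he0
  have h2 := card_initSeg hf0
  have hq0 := invCard_nonneg (C := C)
  have hq1 := invCard_le_one (C := C)
  have hR : 0 ≤ if e = f then invCard C * invCard C ^ (e.card - 1) else 0 := by
    split_ifs <;> positivity
  have heq : 𝔼 x : V → C, (invCard C * monoInd (initSeg e) x) * (invCard C * monoInd (initSeg f) x)
      = invCard C ^ 2 * 𝔼 x : V → C, monoInd (initSeg e) x * monoInd (initSeg f) x := by
    rw [mul_expect]
    refine expect_congr rfl fun x _ => by ring
  rw [heq]
  by_cases h : (initSeg e ∩ initSeg f).card ≤ 1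
  · rw [expect_monoInd_mul_monoInd_of_card_inter_le_one (initSeg_nonempty he) (initSeg_nonempty hf) h]
    have : invCard C ^ 2 * (invCard C ^ ((initSeg e).card - 1) * invCard C ^ ((initSeg f).card - 1))
        = invCard C ^ (e.card - 1) * invCard C ^ (f.card - 1) := by
      rw [← pow_add, ← pow_add, ← pow_add]; congr 1; omega
    rw [this, sub_self, abs_zero]
    exact add_nonneg (overlapWeight_nonneg _ _) hR
  · push Not at h
    have hU := card_union_add_card_inter (initSeg e) (initSeg f)
    have hne : (initSeg e ∩ initSeg f).Nonempty := card_pos.1 (by omega)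
    have hUpos : 0 < (initSeg e ∪ initSeg f).card :=
      card_pos.2 (hne.mono (inter_subset_left.trans subset_union_left))
    rw [expect_monoInd_mul_monoInd_of_inter_nonempty hne, ← pow_add, ← pow_add]
    have hle : (invCard C) ^ (e.card - 1 + (f.card - 1))
        ≤ invCard C ^ (2 + ((initSeg e ∪ initSeg f).card - 1)) :=
      pow_le_pow_of_le_one hq0 hq1 (by omega)
    rw [abs_of_nonneg (sub_nonneg.2 hle)]
    refine (sub_le_self _ (pow_nonneg hq0 _)).trans ?_
    by_cases hef : e = f
    · subst hef
      rw [if_pos rfl, ← pow_succ', union_self]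
      refine (le_of_eq ?_).trans (le_add_of_nonneg_left (overlapWeight_nonneg _ _))
      rw [union_self] at hUpos
      congr 1
      omega
    · have hi : 2 ≤ (e ∩ f).card :=
        h.trans_le (card_le_card (inter_subset_inter (initSeg_subset e) (initSeg_subset f)))
      rw [if_neg hef, add_zero, overlapWeight, if_pos ⟨hef, hi⟩]
      have := card_union_le_initSeg he0 hf0
      exact pow_le_pow_of_le_one hq0 hq1 (by omega)

/-- Second moment bound for centered linear combinations of the compensator terms. -/
lemma expect_sq_sum_le {E : Finset (Finset V)} (hE : ∀ e ∈ E, 2 ≤ e.card) {b : Finset V → ℝ}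
    {B : ℝ} (hb : ∀ e, |b e| ≤ B) :
    𝔼 x : V → C, (∑ e ∈ E, b e * (invCard C * monoInd (initSeg e) x
        - invCard C ^ (e.card - 1))) ^ 2
      ≤ B ^ 2 * (overlap C E E + invCard C * meanCount C E) := by
  have hq0 := invCard_nonneg (C := C)
  have hB : 0 ≤ B := (abs_nonneg _).trans (hb ∅)
  have h1 : ∀ x : V → C, (∑ e ∈ E, b e * (invCard C * monoInd (initSeg e) x
        - invCard C ^ (e.card - 1))) ^ 2 = ∑ e ∈ E, ∑ f ∈ E, b e * b f *
        ((invCard C * monoInd (initSeg e) x - invCard C ^ (e.card - 1)) *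
          (invCard C * monoInd (initSeg f) x - invCard C ^ (f.card - 1))) := by
    intro x
    rw [sq, sum_mul_sum]
    exact sum_congr rfl fun e _ => sum_congr rfl fun f _ => by ring
  simp_rw [h1, expect_sum_comm, ← mul_expect]
  have h2 : overlap C E E + invCard C * meanCount C E = ∑ e ∈ E, ∑ f ∈ E,
      (overlapWeight C e f + if e = f then invCard C * invCard C ^ (e.card - 1) else 0) := by
    simp_rw [sum_add_distrib]
    rw [overlap, meanCount, mul_sum]
    congr 1
    refine sum_congr rfl fun e he => ?_
    rw [sum_ite_eq, if_pos he]
  rw [h2, mul_sum]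
  refine sum_le_sum fun e he => ?_
  rw [mul_sum]
  refine sum_le_sum fun f hf => ?_
  have h3 : 𝔼 x : V → C, ((invCard C * monoInd (initSeg e) x - invCard C ^ (e.card - 1)) *
          (invCard C * monoInd (initSeg f) x - invCard C ^ (f.card - 1)))
      = 𝔼 x : V → C, (invCard C * monoInd (initSeg e) x) * (invCard C * monoInd (initSeg f) x)
        - invCard C ^ (e.card - 1) * invCard C ^ (f.card - 1) := by
    have : ∀ x : V → C, ((invCard C * monoInd (initSeg e) x - invCard C ^ (e.card - 1)) *
          (invCard C * monoInd (initSeg f) x - invCard C ^ (f.card - 1)))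
        = (invCard C * monoInd (initSeg e) x) * (invCard C * monoInd (initSeg f) x)
          - (invCard C * monoInd (initSeg e) x) * invCard C ^ (f.card - 1)
          - invCard C ^ (e.card - 1) * (invCard C * monoInd (initSeg f) x)
          + invCard C ^ (e.card - 1) * invCard C ^ (f.card - 1) := fun x => by ring
    simp_rw [this, expect_add_distrib, expect_sub_distrib]
    rw [← expect_mul univ (fun x : V → C => invCard C * monoInd (initSeg e) x),
      ← mul_expect univ (fun x : V → C => invCard C * monoInd (initSeg f) x),
      expect_monoInd_initSeg (hE e he), expect_monoInd_initSeg (hE f hf), Fintype.expect_const]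
    ring
  rw [h3]
  refine (le_abs_self _).trans ?_
  rw [abs_mul, abs_mul, sq]
  exact mul_le_mul (mul_le_mul (hb e) (hb f) (abs_nonneg _) hB)
    (abs_covariance_initSeg_le (hE e he) (hE f hf)) (abs_nonneg _) (mul_nonneg hB hB)

omit [Nonempty C] in
lemma sum_overlapWeight_lastAt_le {E : Finset (Finset V)} (hE : ∀ e ∈ E, e.Nonempty) :
    ∑ k, ∑ e ∈ lastAt E k, ∑ f ∈ lastAt E k, overlapWeight C e f ≤ overlap C E E := by
  rw [overlap, ← sum_sum_lastAt hE fun e => ∑ f ∈ E, overlapWeight C e f]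
  exact sum_le_sum fun k _ => sum_le_sum fun e _ =>
    sum_le_sum_of_subset_of_nonneg (lastAt_subset E k) fun _ _ _ => overlapWeight_nonneg _ _

omit [Nonempty C] in
lemma sum_meanCount_lastAt_mul_le {E : Finset (Finset V)} (hE : ∀ e ∈ E, e.Nonempty) {μ : ℝ}
    (hμ : ∀ k, meanCount C (lastAt E k) ≤ μ) :
    ∑ k, ∑ e ∈ lastAt E k, ∑ f ∈ lastAt E k, invCard C ^ (e.card - 1) * invCard C ^ (f.card - 1)
      ≤ μ * meanCount C E := by
  have hq0 := invCard_nonneg (C := C)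
  rw [meanCount, ← sum_sum_lastAt hE fun e => invCard C ^ (e.card - 1), mul_sum]
  refine sum_le_sum fun k _ => ?_
  rw [← sum_mul_sum]
  exact mul_le_mul_of_nonneg_right (hμ k) (sum_nonneg fun _ _ => pow_nonneg hq0 _)

/-- The expected sum of squares of the increments of the compensator. -/
lemma sum_expect_sq_compensator_le {E : Finset (Finset V)} (hE : ∀ e ∈ E, 2 ≤ e.card) {μ : ℝ}
    (hμ : ∀ k, meanCount C (lastAt E k) ≤ μ) :
    ∑ k, 𝔼 x : V → C, (∑ e ∈ lastAt E k, invCard C * monoInd (initSeg e) x) ^ 2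
      ≤ overlap C E E + invCard C * meanCount C E + μ * meanCount C E := by
  have hE' : ∀ e ∈ E, e.Nonempty := fun e he => card_pos.1 (by have := hE e he; omega)
  have h := sum_meanCount_lastAt_mul_le hE' hμ
  have h' := sum_overlapWeight_lastAt_le (C := C) hE'
  have h'' : ∑ k, ∑ e ∈ lastAt E k, ∑ f ∈ lastAt E k,
      (if e = f then invCard C * invCard C ^ (e.card - 1) else 0) = invCard C * meanCount C E := by
    rw [meanCount, mul_sum, ← sum_sum_lastAt hE' fun e => invCard C * invCard C ^ (e.card - 1)]
    refine sum_congr rfl fun k _ => sum_congr rfl fun e he => ?_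
    rw [sum_ite_eq, if_pos he]
  calc _ ≤ ∑ k, ∑ e ∈ lastAt E k, ∑ f ∈ lastAt E k, (overlapWeight C e f
          + (if e = f then invCard C * invCard C ^ (e.card - 1) else 0)
          + invCard C ^ (e.card - 1) * invCard C ^ (f.card - 1)) := by
        refine sum_le_sum fun k _ => ?_
        simp_rw [sq, sum_mul_sum, expect_sum_comm]
        refine sum_le_sum fun e he => sum_le_sum fun f hf => ?_
        have := (le_abs_self _).trans (abs_covariance_initSeg_le (C := C)
          (hE e (lastAt_subset E k he)) (hE f (lastAt_subset E k hf)))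
        linarith
    _ ≤ _ := by
        simp_rw [sum_add_distrib]
        rw [h'']
        linarith

/-- The expected number of ordered pairs of monochromatic sets with the same largest vertex. -/
lemma sum_expect_pairs_le {E : Finset (Finset V)} (hE : ∀ e ∈ E, e.Nonempty) {μ : ℝ}
    (hμ : ∀ k, meanCount C (lastAt E k) ≤ μ) :
    ∑ k, 𝔼 x : V → C, ((∑ e ∈ lastAt E k, monoInd e x) ^ 2 - ∑ e ∈ lastAt E k, monoInd e x)
      ≤ overlap C E E + μ * meanCount C E := by
  have hq0 := invCard_nonneg (C := C)
  have h := sum_meanCount_lastAt_mul_le hE hμ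
  have h' := sum_overlapWeight_lastAt_le (C := C) hE
  calc _ ≤ ∑ k, ∑ e ∈ lastAt E k, ∑ f ∈ lastAt E k, (overlapWeight C e f
          + invCard C ^ (e.card - 1) * invCard C ^ (f.card - 1)) := by
        refine sum_le_sum fun k _ => ?_
        have : ∀ x : V → C, (∑ e ∈ lastAt E k, monoInd e x) ^ 2 - ∑ e ∈ lastAt E k, monoInd e x
            = ∑ e ∈ lastAt E k, ∑ f ∈ lastAt E k,
              (monoInd e x * monoInd f x - if e = f then monoInd e x else 0) := by
          intro x
          simp_rw [sum_sub_distrib]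
          rw [sq, sum_mul_sum]
          congr 1
          refine sum_congr rfl fun e he => ?_
          rw [sum_ite_eq, if_pos he]
        simp_rw [this, expect_sum_comm]
        refine sum_le_sum fun e he => sum_le_sum fun f hf => ?_
        have hpp : 0 ≤ invCard C ^ (e.card - 1) * invCard C ^ (f.card - 1) := by positivity
        by_cases hef : e = f
        · subst hef
          simp only [monoInd_mul_self, if_true, sub_self, expect_const_zero]
          exact add_nonneg (overlapWeight_nonneg _ _) hpp
        · simp only [if_neg hef, sub_zero]
          by_cases hi : (e ∩ f).card ≤ 1
          · rw [expect_monoInd_mul_monoInd_of_card_inter_le_one (hE e (lastAt_subset E k he))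
              (hE f (lastAt_subset E k hf)) hi]
            exact le_add_of_nonneg_left (overlapWeight_nonneg _ _)
          · push Not at hi
            rw [expect_monoInd_mul_monoInd_of_inter_nonempty (card_pos.1 (by omega)),
              overlapWeight, if_pos ⟨hef, hi⟩]
            exact le_add_of_nonneg_right hpp
    _ ≤ _ := by
        simp_rw [sum_add_distrib]
        linarith

end Order

section PoissonApproximation

open Finset
open scoped BigOperators

lemma norm_prod_one_add_sub_one_le {ι : Type*} (L : Finset ι) (z : ι → ℂ) (t : ι → ℝ)
    (hz : ∀ i, ‖1 + z i‖ ≤ 1) (ht : ∀ i, ‖z i‖ ≤ 2 * t i) :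
    ‖∏ i ∈ L, (1 + z i) - 1‖ ≤ 2 * ∑ i ∈ L, t i := by
  classical
  induction L using Finset.induction_on with
  | empty => simp
  | insert a s ha ih =>
    rw [prod_insert ha, sum_insert ha]
    have h : (1 + z a) * ∏ i ∈ s, (1 + z i) - 1
        = (1 + z a) * (∏ i ∈ s, (1 + z i) - 1) + z a := by ring
    rw [h]
    refine (norm_add_le _ _).trans ?_
    rw [norm_mul]
    have := mul_le_mul (hz a) ih (norm_nonneg _) zero_le_one
    linarith [ht a]

lemma norm_prod_one_add_sub_one_sub_sum_le {ι : Type*} (L : Finset ι) (z : ι → ℂ) (t : ι → ℝ)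
    (hz : ∀ i, ‖1 + z i‖ ≤ 1) (ht : ∀ i, ‖z i‖ ≤ 2 * t i) (ht' : ∀ i, t i * t i = t i) :
    ‖∏ i ∈ L, (1 + z i) - 1 - ∑ i ∈ L, z i‖ ≤ 2 * ((∑ i ∈ L, t i) ^ 2 - ∑ i ∈ L, t i) := by
  classical
  induction L using Finset.induction_on with
  | empty => simp
  | insert a s ha ih =>
    rw [prod_insert ha, sum_insert ha, sum_insert ha]
    have h : (1 + z a) * ∏ i ∈ s, (1 + z i) - 1 - (z a + ∑ i ∈ s, z i)
        = (∏ i ∈ s, (1 + z i) - 1 - ∑ i ∈ s, z i) + z a * (∏ i ∈ s, (1 + z i) - 1) := by ring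
    rw [h]
    refine (norm_add_le _ _).trans ?_
    rw [norm_mul]
    have h0 : 0 ≤ 2 * t a := (norm_nonneg _).trans (ht a)
    have := mul_le_mul (ht a) (norm_prod_one_add_sub_one_le s z t hz ht) (norm_nonneg _) h0
    nlinarith [ht' a]

lemma norm_exp_sub_one_le (z : ℂ) : ‖Complex.exp z - 1‖ ≤ ‖z‖ * Real.exp ‖z‖ := by
  simpa using Complex.norm_exp_sub_sum_le_norm_mul_exp z 1

lemma norm_one_add_sub_exp_le (z : ℂ) : ‖1 + z - Complex.exp z‖ ≤ ‖z‖ ^ 2 * Real.exp ‖z‖ := by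
  rw [norm_sub_rev]
  simpa [sum_range_succ] using Complex.norm_exp_sub_sum_le_norm_mul_exp z 2

lemma norm_exp_le_exp_norm (z : ℂ) : ‖Complex.exp z‖ ≤ Real.exp ‖z‖ := by
  rw [Complex.norm_exp]
  exact Real.exp_le_exp.2 (Complex.re_le_norm z)

lemma norm_mul_exp_neg_sub_one_le {y z : ℂ} {s t K : ℝ} (hy : ‖y - 1 - z‖ ≤ s)
    (hz : ‖z‖ ≤ 2 * t) (ht : t ≤ K) :
    ‖y * Complex.exp (-z) - 1‖ ≤ Real.exp (2 * K) * s + 4 * Real.exp (4 * K) * t ^ 2 := by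
  have h : y * Complex.exp (-z) - 1
      = (y - 1 - z) * Complex.exp (-z) + (1 + z - Complex.exp z) * Complex.exp (-z) := by
    have : Complex.exp z * Complex.exp (-z) = 1 := by rw [← Complex.exp_add]; simp
    linear_combination this
  have hexp : ‖Complex.exp (-z)‖ ≤ Real.exp (2 * K) := by
    refine (norm_exp_le_exp_norm _).trans (Real.exp_le_exp.2 ?_)
    rw [norm_neg]; linarith
  have hz2 : ‖z‖ ^ 2 ≤ 4 * t ^ 2 := by
    have := pow_le_pow_left₀ (norm_nonneg z) hz 2
    linarith [mul_pow (2 : ℝ) t 2]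
  have h2 : ‖1 + z - Complex.exp z‖ ≤ 4 * t ^ 2 * Real.exp (2 * K) :=
    (norm_one_add_sub_exp_le z).trans (mul_le_mul hz2 (Real.exp_le_exp.2 (by linarith))
      (Real.exp_nonneg _) (by positivity))
  have h4 : Real.exp (4 * K) = Real.exp (2 * K) * Real.exp (2 * K) := by
    rw [← Real.exp_add]; ring_nf
  rw [h]
  refine (norm_add_le _ _).trans ?_
  rw [norm_mul, norm_mul, h4]
  have h5 := mul_le_mul hy hexp (norm_nonneg _) ((norm_nonneg _).trans hy)
  have h6 := mul_le_mul h2 hexp (norm_nonneg _) (by positivity)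
  linarith

lemma expect_abs_le_sqrt {ι : Type*} [Fintype ι] [Nonempty ι] {X : ι → ℝ} {s : ℝ}
    (h : 𝔼 x, X x ^ 2 ≤ s) : 𝔼 x, |X x| ≤ √s := by
  refine Real.le_sqrt_of_sq_le (le_trans ?_ h)
  have := expect_mul_sq_le_sq_mul_sq univ (fun x => |X x|) (fun _ => (1 : ℝ))
  simpa using this

variable {V C : Type*} [LinearOrder V] [Fintype V] [Fintype C] [Nonempty C]

/-- Telescoping estimate for a product of adapted factors `Y k` and predictable factors `F k`, in
terms of the conditional expectations of the factors. -/
lemma norm_expect_prod_sub_one_le {Y F : V → (V → C) → ℂ} (hY : ∀ k x, ‖Y k x‖ ≤ 1)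
    (hYv : ∀ k v, k < v → IgnoresColor v (Y k)) (hFv : ∀ k v, k ≤ v → IgnoresColor v (F k))
    {M : ℝ} (hM : ∀ (S : Finset V) x, ‖∏ k ∈ S, F k x‖ ≤ M) (S : Finset V) :
    ‖𝔼 x, ∏ k ∈ S, (Y k x * F k x) - 1‖
      ≤ M * ∑ k ∈ S, 𝔼 x, ‖(𝔼 a, Y k (Function.update x k a)) * F k x - 1‖ := by
  induction S using Finset.induction_on_max with
  | empty => simp
  | insert k s hs ih =>
    have hk : k ∉ s := fun h => lt_irrefl _ (hs k h)
    set G : (V → C) → ℂ := fun x => ∏ j ∈ s, (Y j x * F j x) with hG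
    have hGM : ∀ x, ‖G x‖ ≤ M := by
      intro x
      rw [hG]
      simp only [prod_mul_distrib, norm_mul]
      have h1 : ‖∏ j ∈ s, Y j x‖ ≤ 1 := by
        rw [norm_prod]
        exact prod_le_one (fun _ _ => norm_nonneg _) fun _ _ => hY _ _
      simpa using mul_le_mul h1 (hM s x) (norm_nonneg _) zero_le_one
    have hGk : ∀ x a, G (Function.update x k a) = G x := by
      intro x a
      refine prod_congr rfl fun j hj => ?_
      rw [hYv j k (hs j hj) x a, hFv j k (hs j hj).le x a]
    have h1 : 𝔼 x, ∏ j ∈ insert k s, (Y j x * F j x)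
        = 𝔼 x, G x * (Y k x * F k x - 1) + 𝔼 x, G x := by
      rw [← expect_add_distrib]
      refine expect_congr rfl fun x _ => ?_
      rw [prod_insert hk]
      ring
    have h2 : 𝔼 x, G x * (Y k x * F k x - 1)
        = 𝔼 x, G x * ((𝔼 a, Y k (Function.update x k a)) * F k x - 1) := by
      rw [← expect_update k]
      refine expect_congr rfl fun x _ => ?_
      simp_rw [hGk, hFv k k le_rfl x]
      rw [← mul_expect, expect_sub_distrib, Fintype.expect_const, ← expect_mul]
    rw [h1, h2, sum_insert hk, mul_add, add_sub_assoc]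
    refine (norm_add_le _ _).trans (add_le_add ?_ ih)
    refine (RCLike.norm_expect_le (K := ℂ)).trans ?_
    rw [mul_expect]
    refine expect_le_expect fun x _ => ?_
    rw [norm_mul]
    exact mul_le_mul_of_nonneg_right (hGM x) (norm_nonneg _)

omit [Fintype V] [Nonempty C] in
lemma expect_monoInd_update_last {E : Finset (Finset V)} {k : V} {e : Finset V}
    (he : e ∈ lastAt E k) (he2 : 2 ≤ e.card) (x : V → C) :
    𝔼 a, monoInd e (Function.update x k a) = invCard C * monoInd (initSeg e) x := by
  obtain ⟨-, hk, h⟩ := mem_lastAt.1 he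
  have hi := initSeg_eq_erase hk h
  have := expect_monoInd_insert_update (C := C) (initSeg_nonempty he2) (k := k) (by simp [hi]) x
  rwa [hi, insert_erase hk, ← hi] at this

/-- The increment at `k` of the compensator of the number of monochromatic members of `E`. -/
noncomputable def compensator (E : Finset (Finset V)) (k : V) (x : V → C) : ℝ :=
  ∑ e ∈ lastAt E k, invCard C * monoInd (initSeg e) x

omit [Fintype V] [Nonempty C] in
lemma compensator_nonneg (E : Finset (Finset V)) (k : V) (x : V → C) : 0 ≤ compensator E k x :=
  sum_nonneg fun _ _ => mul_nonneg invCard_nonneg (monoInd_nonneg _ _)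

omit [Fintype V] [Fintype C] [Nonempty C] in
lemma monoInd_initSeg_ignoresColor {E : Finset (Finset V)} {k v : V} (hkv : k ≤ v) {e : Finset V}
    (he : e ∈ lastAt E k) : IgnoresColor v (monoInd (C := C) (initSeg e)) := by
  obtain ⟨-, hk, h⟩ := mem_lastAt.1 he
  refine monoInd_ignoresColor fun hv => ?_
  rw [initSeg_eq_erase hk h, mem_erase] at hv
  exact hv.1 (le_antisymm (h v hv.2) hkv)

omit [Fintype V] [Nonempty C] in
lemma compensator_ignoresColor (E : Finset (Finset V)) {k v : V} (hkv : k ≤ v) :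
    IgnoresColor v (compensator (C := C) E k) := fun x a =>
  sum_congr rfl fun _ he => by rw [monoInd_initSeg_ignoresColor hkv he x a]

lemma sum_stopped_le {a : V → ℝ} (ha : ∀ k, 0 ≤ a k) {K : ℝ} (hK : 0 ≤ K) (S : Finset V) :
    ∑ k ∈ S, (if ∑ j with j ≤ k, a j ≤ K then a k else 0) ≤ K := by
  rw [← sum_filter]
  rcases (S.filter fun k => ∑ j with j ≤ k, a j ≤ K).eq_empty_or_nonempty with h | h
  · simpa [h] using hK
  · obtain ⟨l, hl, hmax⟩ := exists_last h
    refine le_trans (sum_le_sum_of_subset_of_nonneg ?_ fun _ _ _ => ha _) (mem_filter.1 hl).2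
    intro k hk
    simpa using hmax k hk

end PoissonApproximation

section PoissonApproximationMain

open Finset
open scoped BigOperators

variable {V C : Type*} [LinearOrder V] [Fintype V] [Fintype C] [Nonempty C]

omit [Nonempty C] [Fintype C] [LinearOrder V] [Fintype V] in
lemma norm_one_add_mul_monoInd_le {z : ℂ} (hz : ‖z‖ ≤ 1) (e : Finset V) (x : V → C) :
    ‖1 + (z - 1) * monoInd e x‖ ≤ 1 := by
  rcases monoInd_eq_zero_or_one e x with h | h <;> simp [h, hz]

lemma norm_sub_one_mul_le {z : ℂ} (hz : ‖z‖ ≤ 1) {t : ℝ} (ht : 0 ≤ t) :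
    ‖(z - 1) * t‖ ≤ 2 * t := by
  rw [norm_mul, Complex.norm_real, Real.norm_of_nonneg ht]
  refine mul_le_mul_of_nonneg_right ((norm_sub_le _ _).trans ?_) ht
  simpa using by linarith

omit [Fintype V] in
/-- One step of the comparison: the conditional expectation of a block of factors. -/
lemma norm_expect_block_sub_one_le {E : Finset (Finset V)} (hE : ∀ e ∈ E, 2 ≤ e.card)
    {ζ : Finset V → ℂ} (hζ : ∀ e, ‖ζ e‖ ≤ 1) (k : V) (x : V → C) {K : ℝ}
    (hK : compensator E k x ≤ K) :
    ‖(𝔼 a, ∏ e ∈ lastAt E k, (1 + (ζ e - 1) * monoInd e (Function.update x k a)))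
        * Complex.exp (-∑ e ∈ lastAt E k, (ζ e - 1) * (invCard C * monoInd (initSeg e) x : ℝ)) - 1‖
      ≤ Real.exp (2 * K) * (2 * 𝔼 a, ((∑ e ∈ lastAt E k, monoInd e (Function.update x k a)) ^ 2
          - ∑ e ∈ lastAt E k, monoInd e (Function.update x k a)))
        + 4 * Real.exp (4 * K) * compensator E k x ^ 2 := by
  refine norm_mul_exp_neg_sub_one_le ?_ ?_ hK
  · have h : ∑ e ∈ lastAt E k, (ζ e - 1) * ((invCard C * monoInd (initSeg e) x : ℝ) : ℂ)
        = 𝔼 a, ∑ e ∈ lastAt E k, (ζ e - 1) * (monoInd e (Function.update x k a) : ℂ) := by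
      rw [expect_sum_comm]
      refine sum_congr rfl fun e he => ?_
      rw [← mul_expect, ← expect_monoInd_update_last he (hE e (lastAt_subset E k he)),
        Complex.ofReal_expect]
    have h1 : ∀ f g : C → ℂ, 𝔼 a, f a - 1 - 𝔼 a, g a = 𝔼 a, (f a - 1 - g a) := fun f g => by
      rw [expect_sub_distrib, expect_sub_distrib, Fintype.expect_const]
    rw [h, h1, mul_expect]
    refine (RCLike.norm_expect_le (K := ℂ)).trans (expect_le_expect fun a _ => ?_)
    exact norm_prod_one_add_sub_one_sub_sum_le _ _ _
      (fun e => norm_one_add_mul_monoInd_le (hζ e) e _)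
      (fun e => norm_sub_one_mul_le (hζ e) (monoInd_nonneg _ _)) fun e => monoInd_mul_self _ _
  · refine (norm_sum_le _ _).trans ?_
    rw [compensator, mul_sum]
    exact sum_le_sum fun e _ =>
      norm_sub_one_mul_le (hζ e) (mul_nonneg invCard_nonneg (monoInd_nonneg _ _))

/-- Quantitative Poisson approximation for the monochromatic members of a set system. -/
theorem norm_expect_prod_sub_exp_le {E : Finset (Finset V)} (hE : ∀ e ∈ E, 2 ≤ e.card)
    {ζ : Finset V → ℂ} (hζ : ∀ e, ‖ζ e‖ ≤ 1) {Λ μ δ : ℝ} (hΛ : meanCount C E ≤ Λ)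
    (hμ0 : 0 ≤ μ) (hμ : ∀ k, meanCount C (lastAt E k) ≤ μ)
    (hδ : overlap C E E + invCard C * Λ + μ * Λ ≤ δ) :
    ‖(𝔼 x : V → C, ∏ e ∈ E, (1 + (ζ e - 1) * monoInd e x))
        - Complex.exp (∑ e ∈ E, (ζ e - 1) * (invCard C ^ (e.card - 1) : ℝ))‖
      ≤ Real.exp (8 * (Λ + 1)) * (8 * δ + 4 * √δ) := by
  classical
  have hq0 := invCard_nonneg (C := C)
  have hE' : ∀ e ∈ E, e.Nonempty := fun e he => card_pos.1 (by have := hE e he; omega)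
  have ha0 : 0 ≤ meanCount C E := sum_nonneg fun _ _ => pow_nonneg hq0 _
  have hΛ0 : 0 ≤ Λ := ha0.trans hΛ
  have hqΛ : invCard C * meanCount C E ≤ invCard C * Λ := mul_le_mul_of_nonneg_left hΛ hq0
  have hμΛ : μ * meanCount C E ≤ μ * Λ := mul_le_mul_of_nonneg_left hΛ hμ0
  have hμΛ0 : 0 ≤ μ * Λ := mul_nonneg hμ0 hΛ0
  have hqΛ0 : 0 ≤ invCard C * Λ := mul_nonneg hq0 hΛ0
  have hov := overlap_nonneg (C := C) E E
  have hδ0 : 0 ≤ δ := by linarith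
  set K : ℝ := Λ + 1 with hKdef
  have hK0 : 0 ≤ K := by linarith
  set Y : V → (V → C) → ℂ := fun k x => ∏ e ∈ lastAt E k, (1 + (ζ e - 1) * monoInd e x) with hYdef
  set φ : V → (V → C) → ℂ := fun k x =>
    ∑ e ∈ lastAt E k, (ζ e - 1) * (invCard C * monoInd (initSeg e) x : ℝ) with hφdef
  set good : V → (V → C) → Prop := fun k x => ∑ j with j ≤ k, compensator E j x ≤ K with hgood
  set Y' : V → (V → C) → ℂ := fun k x => if good k x then Y k x else 1 with hY'def
  set F : V → (V → C) → ℂ := fun k x => if good k x then Complex.exp (-φ k x) else 1 with hFdef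
  have hgoodv : ∀ k v, k ≤ v → ∀ x a, good k (Function.update x v a) ↔ good k x := by
    intro k v hkv x a
    have : ∑ j with j ≤ k, compensator E j (Function.update x v a)
        = ∑ j with j ≤ k, compensator E j x :=
      sum_congr rfl fun j hj => compensator_ignoresColor E ((mem_filter.1 hj).2.trans hkv) x a
    simp only [hgood, this]
  have hYnorm : ∀ k x, ‖Y k x‖ ≤ 1 := fun k x => by
    rw [hYdef]
    simp only [norm_prod]
    exact prod_le_one (fun _ _ => norm_nonneg _) fun e _ =>
      norm_one_add_mul_monoInd_le (hζ e) e x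
  have hY' : ∀ k x, ‖Y' k x‖ ≤ 1 := fun k x => by
    simp only [hY'def]
    split_ifs
    · exact hYnorm k x
    · simp
  have hYv : ∀ k v, k < v → IgnoresColor v (Y k) := fun k v hkv x a =>
    prod_congr rfl fun e he => by
      rw [monoInd_ignoresColor (fun hv => (((mem_lastAt.1 he).2.2 v hv).trans_lt hkv).false) x a]
  have hY'v : ∀ k v, k < v → IgnoresColor v (Y' k) := fun k v hkv x a => by
    simp only [hY'def, hgoodv k v hkv.le x a, hYv k v hkv x a]
  have hφv : ∀ k v, k ≤ v → IgnoresColor v (φ k) := fun k v hkv x a =>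
    sum_congr rfl fun e he => by rw [monoInd_initSeg_ignoresColor hkv he x a]
  have hFv : ∀ k v, k ≤ v → IgnoresColor v (F k) := fun k v hkv x a => by
    simp only [hFdef, hgoodv k v hkv x a, hφv k v hkv x a]
  have hφnorm : ∀ k x, ‖φ k x‖ ≤ 2 * compensator E k x := fun k x => by
    refine (norm_sum_le _ _).trans ?_
    rw [compensator, mul_sum]
    exact sum_le_sum fun e _ =>
      norm_sub_one_mul_le (hζ e) (mul_nonneg hq0 (monoInd_nonneg _ _))
  have hM : ∀ (S : Finset V) x, ‖∏ k ∈ S, F k x‖ ≤ Real.exp (2 * K) := by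
    intro S x
    rw [norm_prod]
    calc ∏ k ∈ S, ‖F k x‖ ≤ ∏ k ∈ S, Real.exp (2 * if good k x then compensator E k x else 0) := by
          refine prod_le_prod (fun _ _ => norm_nonneg _) fun k _ => ?_
          simp only [hFdef]
          split_ifs
          · refine (norm_exp_le_exp_norm _).trans (Real.exp_le_exp.2 ?_)
            rw [norm_neg]
            exact hφnorm k x
          · simp
      _ = Real.exp (2 * ∑ k ∈ S, if good k x then compensator E k x else 0) := by
          rw [← Real.exp_sum, mul_sum]
      _ ≤ Real.exp (2 * K) := by
          refine Real.exp_le_exp.2 (mul_le_mul_of_nonneg_left ?_ zero_le_two)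
          exact sum_stopped_le (fun k => compensator_nonneg E k x) hK0 S
  have hcomp : ∀ k x, good k x → compensator E k x ≤ K := fun k x h =>
    (single_le_sum (f := fun j => compensator E j x) (fun j _ => compensator_nonneg E j x)
      (by simp)).trans h
  have hstep : ∀ k, 𝔼 x, ‖(𝔼 a, Y' k (Function.update x k a)) * F k x - 1‖
      ≤ Real.exp (2 * K) * (2 * 𝔼 x : V → C, ((∑ e ∈ lastAt E k, monoInd e x) ^ 2
          - ∑ e ∈ lastAt E k, monoInd e x))
        + 4 * Real.exp (4 * K) * 𝔼 x : V → C, compensator E k x ^ 2 := by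
    intro k
    rw [← expect_update k fun x : V → C => ((∑ e ∈ lastAt E k, monoInd e x) ^ 2
          - ∑ e ∈ lastAt E k, monoInd e x), mul_expect, mul_expect, mul_expect,
      ← expect_add_distrib]
    refine expect_le_expect fun x _ => ?_
    by_cases hg : good k x
    · simp only [hY'def, hFdef, hgoodv k k le_rfl x, hg, if_true]
      exact norm_expect_block_sub_one_le hE hζ k x (hcomp k x hg)
    · simp only [hY'def, hFdef, hgoodv k k le_rfl x, hg, if_false, Fintype.expect_const]
      rw [one_mul, sub_self, norm_zero]
      refine add_nonneg (mul_nonneg (Real.exp_nonneg _) (mul_nonneg zero_le_two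
        (expect_nonneg fun a _ => ?_))) (by positivity)
      have := (norm_nonneg _).trans (norm_prod_one_add_sub_one_sub_sum_le (lastAt E k)
        (fun e => ((0 : ℂ) - 1) * (monoInd e (Function.update x k a) : ℂ))
        (fun e => monoInd e (Function.update x k a))
        (fun e => norm_one_add_mul_monoInd_le (by simp) e _)
        (fun e => norm_sub_one_mul_le (by simp) (monoInd_nonneg _ _)) fun e => monoInd_mul_self _ _)
      linarith
  have hexp24 : Real.exp (2 * K) ≤ Real.exp (4 * K) := Real.exp_le_exp.2 (by linarith)
  have hmain : ‖𝔼 x, ∏ k, (Y' k x * F k x) - 1‖ ≤ Real.exp (2 * K) * (6 * Real.exp (4 * K) * δ) := by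
    refine (norm_expect_prod_sub_one_le hY' hY'v hFv hM univ).trans
      (mul_le_mul_of_nonneg_left ?_ (Real.exp_nonneg _))
    refine (sum_le_sum fun k _ => hstep k).trans ?_
    rw [sum_add_distrib, ← mul_sum, ← mul_sum, ← mul_sum]
    have h1 := sum_expect_pairs_le (C := C) hE' hμ
    have h2 := sum_expect_sq_compensator_le (C := C) hE hμ
    have h1' : Real.exp (2 * K) * (2 * ∑ k, 𝔼 x : V → C, ((∑ e ∈ lastAt E k, monoInd e x) ^ 2
          - ∑ e ∈ lastAt E k, monoInd e x)) ≤ Real.exp (4 * K) * (2 * δ) := by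
      refine (mul_le_mul_of_nonneg_left (?_ : _ ≤ 2 * δ) (Real.exp_nonneg _)).trans
        (mul_le_mul_of_nonneg_right hexp24 (by linarith))
      linarith
    have h2' : 4 * Real.exp (4 * K) * ∑ k, 𝔼 x : V → C, compensator E k x ^ 2
        ≤ 4 * Real.exp (4 * K) * δ := by
      refine mul_le_mul_of_nonneg_left ?_ (by positivity)
      refine h2.trans ?_
      linarith
    linarith
  set Φ : ℂ := ∑ e ∈ E, (ζ e - 1) * (invCard C ^ (e.card - 1) : ℝ) with hΦ
  have hΦnorm : ‖Φ‖ ≤ 2 * Λ := by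
    refine (norm_sum_le _ _).trans (le_trans ?_ (mul_le_mul_of_nonneg_left hΛ zero_le_two))
    rw [meanCount, mul_sum]
    exact sum_le_sum fun e _ => norm_sub_one_mul_le (hζ e) (pow_nonneg hq0 _)
  set dev : (V → C) → ℂ := fun x => ∑ e ∈ E, (ζ e - 1) *
    (invCard C * monoInd (initSeg e) x - invCard C ^ (e.card - 1) : ℝ) with hdev
  set A : (V → C) → ℝ := fun x => ∑ e ∈ E, 1 *
    (invCard C * monoInd (initSeg e) x - invCard C ^ (e.card - 1)) with hA
  have hdevsum : ∀ x, dev x = ∑ k, φ k x - Φ := by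
    intro x
    rw [hφdef, sum_sum_lastAt hE' fun e => (ζ e - 1) * (invCard C * monoInd (initSeg e) x : ℝ),
      hΦ, ← sum_sub_distrib]
    refine sum_congr rfl fun e _ => ?_
    push_cast
    ring
  have hAsum : ∀ x, A x = ∑ k, compensator E k x - meanCount C E := by
    intro x
    simp only [compensator]
    rw [sum_sum_lastAt hE' fun e => invCard C * monoInd (initSeg e) x, meanCount,
      ← sum_sub_distrib]
    simp [hA]
  have hquad : overlap C E E + invCard C * meanCount C E ≤ δ := by linarith
  have hAsq : 𝔼 x, A x ^ 2 ≤ δ := by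
    refine (expect_sq_sum_le hE (b := fun _ => 1) (B := 1) (fun _ => by simp)).trans ?_
    linarith
  have hnorm2 : ∀ e, ‖ζ e - 1‖ ≤ 2 := fun e => by
    simpa using norm_sub_one_mul_le (hζ e) zero_le_one
  have hdevnorm : 𝔼 x, ‖dev x‖ ≤ 4 * √δ := by
    have hre : 𝔼 x, |(dev x).re| ≤ √(2 ^ 2 * δ) := by
      refine expect_abs_le_sqrt (le_trans (le_of_eq ?_) ((expect_sq_sum_le (C := C) hE
        (b := fun e => (ζ e - 1).re) (B := 2)
        (fun e => (Complex.abs_re_le_norm _).trans (hnorm2 e))).trans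
        (mul_le_mul_of_nonneg_left hquad (by norm_num))))
      refine expect_congr rfl fun x _ => ?_
      simp only [hdev, Complex.re_sum, Complex.re_mul_ofReal]
    have him : 𝔼 x, |(dev x).im| ≤ √(2 ^ 2 * δ) := by
      refine expect_abs_le_sqrt (le_trans (le_of_eq ?_) ((expect_sq_sum_le (C := C) hE
        (b := fun e => (ζ e - 1).im) (B := 2)
        (fun e => (Complex.abs_im_le_norm _).trans (hnorm2 e))).trans
        (mul_le_mul_of_nonneg_left hquad (by norm_num))))
      refine expect_congr rfl fun x _ => ?_
      simp only [hdev, Complex.im_sum, Complex.im_mul_ofReal]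
    have hsq : √(2 ^ 2 * δ) = 2 * √δ := by
      rw [Real.sqrt_mul (by norm_num), Real.sqrt_sq (by norm_num)]
    rw [hsq] at hre him
    calc 𝔼 x, ‖dev x‖ ≤ 𝔼 x, (|(dev x).re| + |(dev x).im|) :=
          expect_le_expect fun x _ => Complex.norm_le_abs_re_add_abs_im _
      _ ≤ 4 * √δ := by rw [expect_add_distrib]; linarith
  have hprodY : ∀ x, ∏ e ∈ E, (1 + (ζ e - 1) * monoInd e x) = ∏ k, Y k x := fun x =>
    (prod_prod_lastAt hE' fun e => (1 + (ζ e - 1) * (monoInd e x : ℂ))).symm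
  have hpoint : ∀ x, ‖∏ k, Y k x - Complex.exp Φ * ∏ k, (Y' k x * F k x)‖
      ≤ Real.exp (4 * K) * (‖dev x‖ + 2 * A x ^ 2) := by
    intro x
    have hprodnorm : ‖∏ k, Y k x‖ ≤ 1 := by
      rw [norm_prod]
      exact prod_le_one (fun _ _ => norm_nonneg _) fun _ _ => hYnorm _ _
    by_cases hx : ∑ k, compensator E k x ≤ K
    · have hg : ∀ k, good k x := fun k =>
        (sum_le_sum_of_subset_of_nonneg (filter_subset _ _) fun j _ _ =>
          compensator_nonneg E j x).trans hx
      have h1 : ∏ k, (Y' k x * F k x) = (∏ k, Y k x) * Complex.exp (-∑ k, φ k x) := by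
        simp only [hY'def, hFdef, hg, if_true]
        rw [prod_mul_distrib, ← Complex.exp_sum, sum_neg_distrib]
      have h2 : ∏ k, Y k x - Complex.exp Φ * ((∏ k, Y k x) * Complex.exp (-∑ k, φ k x))
          = -((∏ k, Y k x) * (Complex.exp (-dev x) - 1)) := by
        have : Complex.exp (-dev x) = Complex.exp Φ * Complex.exp (-∑ k, φ k x) := by
          rw [← Complex.exp_add, hdevsum]; ring_nf
        rw [this]; ring
      have h3 : ‖dev x‖ ≤ 4 * K := by
        rw [hdevsum]
        refine (norm_sub_le _ _).trans ?_
        have : ‖∑ k, φ k x‖ ≤ 2 * K := (norm_sum_le _ _).trans ((sum_le_sum fun k _ =>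
          hφnorm k x).trans (by rw [← mul_sum]; linarith))
        linarith
      rw [h1, h2, norm_neg, norm_mul]
      have h4 := norm_exp_sub_one_le (-dev x)
      rw [norm_neg] at h4
      have h5 : ‖dev x‖ * Real.exp ‖dev x‖ ≤ ‖dev x‖ * Real.exp (4 * K) :=
        mul_le_mul_of_nonneg_left (Real.exp_le_exp.2 h3) (norm_nonneg _)
      have h6 := mul_le_mul hprodnorm (h4.trans h5) (norm_nonneg _) zero_le_one
      have h7 : 0 ≤ Real.exp (4 * K) * (2 * A x ^ 2) := by positivity
      linarith
    · push Not at hx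
      have hA1 : 1 ≤ A x ^ 2 := by
        have : 1 ≤ A x := by rw [hAsum]; linarith
        nlinarith
      have h1 : ‖∏ k, (Y' k x * F k x)‖ ≤ Real.exp (2 * K) := by
        rw [prod_mul_distrib, norm_mul]
        have : ‖∏ k, Y' k x‖ ≤ 1 := by
          rw [norm_prod]
          exact prod_le_one (fun _ _ => norm_nonneg _) fun _ _ => hY' _ _
        simpa using mul_le_mul this (hM univ x) (norm_nonneg _) zero_le_one
      have h2 : ‖Complex.exp Φ‖ ≤ Real.exp (2 * K) :=
        (norm_exp_le_exp_norm _).trans (Real.exp_le_exp.2 (by linarith))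
      have h3 : Real.exp (2 * K) * Real.exp (2 * K) = Real.exp (4 * K) := by
        rw [← Real.exp_add]; ring_nf
      have h4 : 1 ≤ Real.exp (4 * K) := Real.one_le_exp (by linarith)
      have h5 := mul_le_mul h2 h1 (norm_nonneg _) (Real.exp_nonneg _)
      rw [← norm_mul, h3] at h5
      have h6 := (norm_sub_le (∏ k, Y k x) (Complex.exp Φ * ∏ k, (Y' k x * F k x))).trans
        (add_le_add hprodnorm h5)
      have h7 : Real.exp (4 * K) * 2 ≤ Real.exp (4 * K) * (‖dev x‖ + 2 * A x ^ 2) :=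
        mul_le_mul_of_nonneg_left (by linarith [norm_nonneg (dev x)]) (Real.exp_nonneg _)
      linarith
  have hfin : (𝔼 x : V → C, ∏ e ∈ E, (1 + (ζ e - 1) * (monoInd e x : ℂ))) - Complex.exp Φ
      = 𝔼 x, (∏ k, Y k x - Complex.exp Φ * ∏ k, (Y' k x * F k x))
        + Complex.exp Φ * (𝔼 x, ∏ k, (Y' k x * F k x) - 1) := by
    simp_rw [hprodY]
    rw [expect_sub_distrib, ← mul_expect]
    ring
  rw [hfin]
  refine (norm_add_le _ _).trans ?_
  have hT1 : ‖𝔼 x, (∏ k, Y k x - Complex.exp Φ * ∏ k, (Y' k x * F k x))‖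
      ≤ Real.exp (4 * K) * (4 * √δ + 2 * δ) := by
    refine (RCLike.norm_expect_le (K := ℂ)).trans ((expect_le_expect fun x _ => hpoint x).trans ?_)
    rw [← mul_expect, expect_add_distrib, ← mul_expect]
    exact mul_le_mul_of_nonneg_left (by linarith) (Real.exp_nonneg _)
  have hT2 : ‖Complex.exp Φ * (𝔼 x, ∏ k, (Y' k x * F k x) - 1)‖
      ≤ Real.exp (8 * K) * (6 * δ) := by
    rw [norm_mul]
    have h2 : ‖Complex.exp Φ‖ ≤ Real.exp (2 * K) :=
      (norm_exp_le_exp_norm _).trans (Real.exp_le_exp.2 (by linarith))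
    refine (mul_le_mul h2 hmain (norm_nonneg _) (Real.exp_nonneg _)).trans (le_of_eq ?_)
    have : Real.exp (8 * K) = Real.exp (2 * K) * (Real.exp (2 * K) * Real.exp (4 * K)) := by
      rw [← Real.exp_add, ← Real.exp_add]; ring_nf
    rw [this]; ring
  have hexp48 : Real.exp (4 * K) ≤ Real.exp (8 * K) := Real.exp_le_exp.2 (by linarith)
  have hT1' := mul_le_mul_of_nonneg_right hexp48 (by positivity : 0 ≤ 4 * √δ + 2 * δ)
  linarith

end PoissonApproximationMain

section Overlap

open Finset
open scoped BigOperators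

variable {V C : Type*} [Fintype C]

lemma meanCount_nonneg (E : Finset (Finset V)) : 0 ≤ meanCount C E :=
  sum_nonneg fun _ _ => pow_nonneg invCard_nonneg _

lemma invCard_pow_card_sub_one_le {e : Finset V} (he : 2 ≤ e.card) :
    invCard C ^ (e.card - 1) ≤ invCard C := by
  simpa using pow_le_pow_of_le_one invCard_nonneg (invCard_le_one (C := C))
    (by omega : 1 ≤ e.card - 1)

lemma exists_linearOrder_antitone [Finite V] (d : V → ℝ) :
    ∃ o : LinearOrder V, ∀ u v : V, o.le u v → d v ≤ d u := by
  classical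
  obtain ⟨n, ⟨g⟩⟩ := Finite.exists_equiv_fin V
  let key : V → ℝᵒᵈ ×ₗ Fin n := fun v => toLex (OrderDual.toDual (d v), g v)
  have hkey : Function.Injective key := fun u v h =>
    g.injective (congrArg (fun z => (ofLex z).2) h)
  refine ⟨LinearOrder.lift' key hkey, fun u v h => ?_⟩
  have h' : key u ≤ key v := h
  rcases (Prod.Lex.le_iff.1 h') with h1 | h1
  · exact le_of_lt h1
  · exact le_of_eq (congrArg OrderDual.ofDual h1.1).symm

open Classical in
variable (C) in
/-- The expected number of monochromatic members of `E` containing `v`. -/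
noncomputable def weightedDegree (E : Finset (Finset V)) (v : V) : ℝ :=
  meanCount C (E.filter fun e => v ∈ e)

lemma sum_weightedDegree [Fintype V] (E : Finset (Finset V)) :
    ∑ v, weightedDegree C E v = ∑ e ∈ E, e.card * invCard C ^ (e.card - 1) := by
  classical
  simp_rw [weightedDegree, meanCount, sum_filter]
  rw [Finset.sum_comm]
  refine sum_congr rfl fun e _ => ?_
  simp

/-- If the vertices are ordered by decreasing weighted degree, then the members of `E` with a given
largest vertex have small total expectation. -/
lemma meanCount_lastAt_le [Fintype V] [LinearOrder V] {E : Finset (Finset V)} {R : ℕ}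
    (hE : ∀ e ∈ E, 2 ≤ e.card) (hR : ∀ e ∈ E, e.card ≤ R) {Λ ε : ℝ} (hε : 0 < ε)
    (hΛ : meanCount C E ≤ Λ)
    (hmono : ∀ u v : V, u ≤ v → weightedDegree C E v ≤ weightedDegree C E u) (k : V) :
    meanCount C (lastAt E k) ≤ ε + 2 ^ ⌊R * Λ / ε⌋₊ * invCard C := by
  classical
  have hq0 := invCard_nonneg (C := C)
  have hΛ0 : 0 ≤ Λ := (meanCount_nonneg E).trans hΛ
  by_cases hk : weightedDegree C E k < ε
  · have h1 : meanCount C (lastAt E k) ≤ weightedDegree C E k := by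
      refine sum_le_sum_of_subset_of_nonneg (fun e he => ?_) fun _ _ _ => pow_nonneg hq0 _
      exact (@mem_filter _ _ (_) _ _).2 ⟨(mem_lastAt.1 he).1, (mem_lastAt.1 he).2.1⟩
    have h2 : 0 ≤ 2 ^ ⌊R * Λ / ε⌋₊ * invCard C := by positivity
    linarith
  · push Not at hk
    set heavy : Finset V := univ.filter fun v => ε ≤ weightedDegree C E v with hheavy
    have hsum : ∑ v, weightedDegree C E v ≤ R * Λ := by
      rw [sum_weightedDegree]
      refine le_trans ?_ (mul_le_mul_of_nonneg_left hΛ (Nat.cast_nonneg R))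
      rw [meanCount, mul_sum]
      exact sum_le_sum fun e he => mul_le_mul_of_nonneg_right (by exact_mod_cast hR e he)
        (pow_nonneg hq0 _)
    have hcard : heavy.card ≤ ⌊R * Λ / ε⌋₊ := by
      refine Nat.le_floor ?_
      rw [le_div_iff₀ hε, ← nsmul_eq_mul]
      refine (card_nsmul_le_sum heavy _ ε fun v hv => (mem_filter.1 hv).2).trans
        (le_trans ?_ hsum)
      exact sum_le_sum_of_subset_of_nonneg (subset_univ _) fun v _ _ => meanCount_nonneg _
    have hsub : lastAt E k ⊆ heavy.powerset := by
      intro e he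
      refine mem_powerset.2 fun u hu => mem_filter.2 ⟨mem_univ _, hk.trans ?_⟩
      exact hmono u k ((mem_lastAt.1 he).2.2 u hu)
    have h1 : meanCount C (lastAt E k) ≤ (lastAt E k).card • invCard C :=
      sum_le_card_nsmul _ _ _ fun e he => invCard_pow_card_sub_one_le (hE e (mem_lastAt.1 he).1)
    have h2 : ((lastAt E k).card : ℝ) ≤ 2 ^ ⌊R * Λ / ε⌋₊ := by
      have h3 := card_le_card hsub
      rw [card_powerset] at h3
      exact_mod_cast h3.trans (Nat.pow_le_pow_right two_pos hcard)
    rw [nsmul_eq_mul] at h1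
    have h4 := mul_le_mul_of_nonneg_right h2 hq0
    linarith

variable [Nonempty C]

lemma invCard_inv_pow_mul {s m : ℕ} (h : s ≤ m) :
    (invCard C)⁻¹ ^ s * invCard C ^ m = invCard C ^ (m - s) := by
  have hq : invCard C ≠ 0 := invCard_pos.ne'
  obtain ⟨d, rfl⟩ := Nat.exists_eq_add_of_le h
  rw [Nat.add_sub_cancel_left, pow_add, ← mul_assoc, ← mul_pow, inv_mul_cancel₀ hq, one_pow,
    one_mul]

variable [DecidableEq V] [Fintype V]

lemma expect_sum_monoInd {E : Finset (Finset V)} (hE : ∀ e ∈ E, 2 ≤ e.card) :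
    𝔼 x : V → C, ∑ e ∈ E, monoInd e x = meanCount C E := by
  rw [expect_sum_comm]
  exact sum_congr rfl fun e he => expect_monoInd (card_pos.1 (by have := hE e he; omega))

/-- The overlap of a set system is controlled by the difference of variance and mean. -/
lemma overlap_le_variance_sub_mean {E : Finset (Finset V)} (hE : ∀ e ∈ E, 2 ≤ e.card) :
    (1 - invCard C) * overlap C E E ≤ 𝔼 x : V → C, (∑ e ∈ E, monoInd e x) ^ 2
      - meanCount C E ^ 2 - meanCount C E + invCard C * meanCount C E := by
  have hq0 := invCard_nonneg (C := C)
  have hq1 := invCard_le_one (C := C)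
  have h1 : (1 - invCard C) * overlap C E E + (1 - invCard C) * meanCount C E
      = ∑ e ∈ E, ∑ f ∈ E, ((1 - invCard C) * overlapWeight C e f
        + if e = f then (1 - invCard C) * invCard C ^ (e.card - 1) else 0) := by
    simp_rw [sum_add_distrib, ← mul_sum]
    rw [overlap, meanCount, mul_sum E (fun e => invCard C ^ (e.card - 1))]
    congr 1
    refine sum_congr rfl fun e he => ?_
    rw [sum_ite_eq, if_pos he]
  have h2 : 𝔼 x : V → C, (∑ e ∈ E, monoInd e x) ^ 2 - meanCount C E ^ 2
      = ∑ e ∈ E, ∑ f ∈ E, (𝔼 x : V → C, monoInd e x * monoInd f x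
        - invCard C ^ (e.card - 1) * invCard C ^ (f.card - 1)) := by
    simp_rw [sum_sub_distrib, ← expect_sum_comm, sq, meanCount, sum_mul_sum]
  suffices h : (1 - invCard C) * overlap C E E + (1 - invCard C) * meanCount C E
      ≤ 𝔼 x : V → C, (∑ e ∈ E, monoInd e x) ^ 2 - meanCount C E ^ 2 by linarith
  rw [h1, h2]
  refine sum_le_sum fun e he => sum_le_sum fun f hf => ?_
  have he2 := hE e he
  have hf2 := hE f hf
  have he0 : e.Nonempty := card_pos.1 (by omega)
  by_cases hef : e = f
  · subst hef
    simp only [monoInd_mul_self, if_true, expect_monoInd he0]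
    have hw : overlapWeight C e e = 0 := by simp [overlapWeight]
    have := mul_le_mul_of_nonneg_right (invCard_pow_card_sub_one_le (C := C) he2)
      (pow_nonneg hq0 (e.card - 1))
    rw [hw]
    linarith
  · rw [if_neg hef, add_zero]
    by_cases hi : (e ∩ f).card ≤ 1
    · rw [expect_monoInd_mul_monoInd_of_card_inter_le_one he0 (card_pos.1 (by omega)) hi,
        overlapWeight, if_neg (by omega)]
      simp
    · push Not at hi
      rw [expect_monoInd_mul_monoInd_of_inter_nonempty (card_pos.1 (by omega)), overlapWeight,
        if_pos ⟨hef, hi⟩]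
      have hU := card_union_add_card_inter e f
      have hUpos : 0 < (e ∪ f).card := card_pos.2 (he0.mono subset_union_left)
      have : invCard C ^ (e.card - 1) * invCard C ^ (f.card - 1)
          ≤ invCard C * invCard C ^ ((e ∪ f).card - 1) := by
        rw [← pow_add, ← pow_succ']
        exact pow_le_pow_of_le_one hq0 hq1 (by omega)
      linarith

variable (C) in
/-- The weight of a vertex set `S` in the comparison of overlaps. -/
noncomputable def starWeight (S : Finset V) : ℝ := (invCard C)⁻¹ ^ (S.card + 1)

variable (C) in
/-- The normalized number of members of `E` containing `S`. -/
noncomputable def starDegree (r : ℕ) (E : Finset (Finset V)) (S : Finset V) : ℝ :=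
  ∑ e ∈ E, if S ⊆ e then invCard C ^ r else 0

omit [Nonempty C] [Fintype V] in
lemma starWeight_mul_starDegree_mul (r s : ℕ) (E F : Finset (Finset V)) (𝒮 : Finset (Finset V)) :
    ∑ S ∈ 𝒮, starWeight C S * (starDegree C r E S * starDegree C s F S)
      = ∑ e ∈ E, ∑ f ∈ F, ∑ S ∈ 𝒮 with S ⊆ e ∧ S ⊆ f,
        (invCard C)⁻¹ ^ (S.card + 1) * invCard C ^ (r + s) := by
  simp_rw [starDegree, sum_mul_sum, mul_sum, sum_filter]
  rw [Finset.sum_comm]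
  refine sum_congr rfl fun e _ => ?_
  rw [Finset.sum_comm]
  refine sum_congr rfl fun f _ => sum_congr rfl fun S _ => ?_
  by_cases he : S ⊆ e <;> by_cases hf : S ⊆ f <;> simp [he, hf, starWeight, pow_add]

lemma sum_starWeight_mul_sq_le {r t : ℕ} (htr : t ≤ r) {E : Finset (Finset V)}
    (hE : ∀ e ∈ E, e.card = r) :
    ∑ S : Finset V with 2 ≤ S.card ∧ S.card ≤ t,
        starWeight C S * (starDegree C r E S * starDegree C r E S)
      ≤ 2 ^ r * (overlap C E E + invCard C ^ (r - t) * meanCount C E) := by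
  have hq0 := invCard_nonneg (C := C)
  have hq1 := invCard_le_one (C := C)
  have h2 : overlap C E E + invCard C ^ (r - t) * meanCount C E = ∑ e ∈ E, ∑ f ∈ E,
      (overlapWeight C e f
        + if e = f then invCard C ^ (r - t) * invCard C ^ (e.card - 1) else 0) := by
    simp_rw [sum_add_distrib]
    rw [overlap, meanCount, mul_sum]
    congr 1
    refine sum_congr rfl fun e he => ?_
    rw [sum_ite_eq, if_pos he]
  rw [starWeight_mul_starDegree_mul, h2, mul_sum]
  refine sum_le_sum fun e he => ?_
  rw [mul_sum]
  refine sum_le_sum fun f hf => ?_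
  have he' := hE e he
  have hf' := hE f hf
  set B := overlapWeight C e f
    + if e = f then invCard C ^ (r - t) * invCard C ^ (e.card - 1) else 0 with hB
  have hB0 : 0 ≤ B := add_nonneg (overlapWeight_nonneg _ _) (by split_ifs <;> positivity)
  set 𝒯 := (univ.filter fun S : Finset V => 2 ≤ S.card ∧ S.card ≤ t).filter
    fun S => S ⊆ e ∧ S ⊆ f with h𝒯
  have hcard : 𝒯.card ≤ 2 ^ r := by
    rw [← he', ← card_powerset]
    refine card_le_card fun S hS => ?_
    exact mem_powerset.2 (mem_filter.1 hS).2.1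
  have hterm : ∀ S ∈ 𝒯, (invCard C)⁻¹ ^ (S.card + 1) * invCard C ^ (r + r) ≤ B := by
    intro S hS
    obtain ⟨hS1, hSe, hSf⟩ := mem_filter.1 hS
    obtain ⟨hS2, hSt⟩ := (mem_filter.1 hS1).2
    rw [invCard_inv_pow_mul (by omega)]
    have hw0 := overlapWeight_nonneg (C := C) e f
    by_cases hef : e = f
    · rw [hB, if_pos hef, ← pow_add]
      refine le_trans ?_ (le_add_of_nonneg_left hw0)
      exact pow_le_pow_of_le_one hq0 hq1 (by omega)
    · have hSi := card_le_card (subset_inter hSe hSf)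
      have hU := card_union_add_card_inter e f
      rw [hB, if_neg hef, add_zero, overlapWeight, if_pos ⟨hef, hS2.trans hSi⟩]
      exact pow_le_pow_of_le_one hq0 hq1 (by omega)
  refine (sum_le_card_nsmul 𝒯 _ B hterm).trans ?_
  rw [nsmul_eq_mul]
  exact mul_le_mul_of_nonneg_right (by exact_mod_cast hcard) hB0

/-- The overlap between two uniform layers is controlled by the overlaps within the layers. -/
lemma overlap_sq_le {r s : ℕ} (hrs : r < s) {E F : Finset (Finset V)}
    (hE : ∀ e ∈ E, e.card = r) (hF : ∀ f ∈ F, f.card = s) :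
    overlap C E F ^ 2 ≤ (2 ^ r * (overlap C E E + meanCount C E))
      * (2 ^ s * (overlap C F F + invCard C * meanCount C F)) := by
  have hq0 := invCard_nonneg (C := C)
  have hq1 := invCard_le_one (C := C)
  have h1 := sum_starWeight_mul_sq_le (C := C) (le_refl r) hE
  have h2 := sum_starWeight_mul_sq_le (C := C) hrs.le hF
  have h2' : invCard C ^ (s - r) * meanCount C F ≤ invCard C * meanCount C F := by
    refine mul_le_mul_of_nonneg_right ?_ (meanCount_nonneg F)
    simpa using pow_le_pow_of_le_one hq0 hq1 (by omega : 1 ≤ s - r)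
  rw [Nat.sub_self, pow_zero, one_mul] at h1
  have hpos : 0 < invCard C := invCard_pos
  have hle : overlap C E F ≤ ∑ S : Finset V with 2 ≤ S.card ∧ S.card ≤ r,
      starWeight C S * (starDegree C r E S * starDegree C s F S) := by
    rw [starWeight_mul_starDegree_mul]
    refine sum_le_sum fun e he => sum_le_sum fun f hf => ?_
    have he' := hE e he
    have hf' := hF f hf
    have hnn : ∀ S : Finset V, 0 ≤ (invCard C)⁻¹ ^ (S.card + 1) * invCard C ^ (r + s) :=
      fun S => by positivity
    rw [overlapWeight]
    split_ifs with h
    · have hU := card_union_add_card_inter e f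
      have hi := card_le_card (inter_subset_left (s₁ := e) (s₂ := f))
      have heq : invCard C ^ ((e ∪ f).card - 1)
          = (invCard C)⁻¹ ^ ((e ∩ f).card + 1) * invCard C ^ (r + s) := by
        rw [invCard_inv_pow_mul (by omega)]
        congr 1
        omega
      rw [heq]
      refine single_le_sum
        (f := fun S : Finset V => (invCard C)⁻¹ ^ (S.card + 1) * invCard C ^ (r + s))
        (fun S _ => hnn S) ?_
      refine mem_filter.2 ⟨mem_filter.2 ⟨mem_univ _, h.2, by omega⟩, inter_subset_left,
        inter_subset_right⟩
    · exact sum_nonneg fun S _ => hnn S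
  refine (pow_le_pow_left₀ (overlap_nonneg E F) hle 2).trans ?_
  have hw : ∀ S : Finset V, 0 ≤ starWeight C S := fun S => by unfold starWeight; positivity
  refine (sum_sq_le_sum_mul_sum_of_sq_le_mul _
    (f := fun S => starWeight C S * (starDegree C r E S * starDegree C r E S))
    (g := fun S => starWeight C S * (starDegree C s F S * starDegree C s F S))
    (fun S _ => mul_nonneg (hw S) (mul_self_nonneg _))
    (fun S _ => mul_nonneg (hw S) (mul_self_nonneg _)) (fun S _ => le_of_eq (by ring))).trans ?_
  refine mul_le_mul h1 (h2.trans ?_) (sum_nonneg fun S _ => mul_nonneg (hw S) (mul_self_nonneg _))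
    (mul_nonneg (by positivity) (add_nonneg (overlap_nonneg _ _) (meanCount_nonneg _)))
  exact mul_le_mul_of_nonneg_left (by linarith) (by positivity)

end Overlap

section TwoLayers

open Finset
open scoped BigOperators

lemma cexp_mul_sum_monoInd {V C : Type*} (t : ℝ) (E : Finset (Finset V)) (x : V → C) :
    Complex.exp (t * (∑ e ∈ E, monoInd e x : ℝ) * Complex.I)
      = ∏ e ∈ E, (1 + (Complex.exp (t * Complex.I) - 1) * monoInd e x) := by
  have h : (t : ℂ) * (∑ e ∈ E, monoInd e x : ℝ) * Complex.I
      = ∑ e ∈ E, t * (monoInd e x : ℂ) * Complex.I := by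
    push_cast
    rw [mul_sum, sum_mul]
  rw [h, Complex.exp_sum]
  refine prod_congr rfl fun e _ => ?_
  rcases monoInd_eq_zero_or_one e x with h | h <;> simp [h]

lemma norm_expect_cexp_sub_exp_le {V C : Type*} [DecidableEq V] [Fintype V] [Fintype C]
    [Nonempty C] {r s : ℕ} (hr : 2 ≤ r) (hrs : r < s) {E F : Finset (Finset V)}
    (hE : ∀ e ∈ E, e.card = r) (hF : ∀ f ∈ F, f.card = s) (t u : ℝ) {Λ ε : ℝ} (hε : 0 < ε)
    (hΛ : meanCount C E + meanCount C F ≤ Λ) :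
    ‖(𝔼 x : V → C, Complex.exp (t * (∑ e ∈ E, monoInd e x : ℝ) * Complex.I)
          * Complex.exp (u * (∑ f ∈ F, monoInd f x : ℝ) * Complex.I))
        - Complex.exp ((Complex.exp (t * Complex.I) - 1) * meanCount C E
          + (Complex.exp (u * Complex.I) - 1) * meanCount C F)‖
      ≤ Real.exp (8 * (Λ + 1)) *
        (8 * (overlap C E E + overlap C F F + 2 * overlap C E F + invCard C * Λ
            + (ε + 2 ^ ⌊s * Λ / ε⌋₊ * invCard C) * Λ)
          + 4 * √(overlap C E E + overlap C F F + 2 * overlap C E F + invCard C * Λ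
            + (ε + 2 ^ ⌊s * Λ / ε⌋₊ * invCard C) * Λ)) := by
  have hdisj : Disjoint E F := disjoint_left.2 fun e he hf => by
    have := hE e he; have := hF e hf; omega
  obtain ⟨o, ho⟩ := exists_linearOrder_antitone (weightedDegree C (E.disjUnion F hdisj))
  have hdec : ‹DecidableEq V› = o.toDecidableEq := Subsingleton.elim _ _
  subst hdec
  set G := E.disjUnion F hdisj with hG
  have hGE : ∀ e ∈ G, e.card = r ∨ e.card = s := fun e he =>
    (mem_disjUnion.1 he).imp (hE e) (hF e)
  have hG2 : ∀ e ∈ G, 2 ≤ e.card := fun e he => by rcases hGE e he with h | h <;> omega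
  have hGs : ∀ e ∈ G, e.card ≤ s := fun e he => by rcases hGE e he with h | h <;> omega
  have hmean : meanCount C G = meanCount C E + meanCount C F := sum_disjUnion hdisj
  have hov : overlap C G G = overlap C E E + overlap C F F + 2 * overlap C E F := by
    have h : overlap C F E = overlap C E F := by
      rw [overlap, Finset.sum_comm]
      exact sum_congr rfl fun e _ => sum_congr rfl fun f _ => overlapWeight_comm _ _
    have h' : overlap C G G
        = (overlap C E E + overlap C E F) + (overlap C F E + overlap C F F) := by
      simp only [overlap, hG, sum_disjUnion, sum_add_distrib]
      ring
    rw [h', h]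
    ring
  set ζ : Finset V → ℂ := fun e =>
    if e.card = r then Complex.exp (t * Complex.I) else Complex.exp (u * Complex.I) with hζdef
  have hζ : ∀ e, ‖ζ e‖ ≤ 1 := fun e => by
    simp only [hζdef]
    split_ifs <;> rw [Complex.norm_exp_ofReal_mul_I]
  have hζE : ∀ e ∈ E, ζ e = Complex.exp (t * Complex.I) := fun e he => if_pos (hE e he)
  have hζF : ∀ f ∈ F, ζ f = Complex.exp (u * Complex.I) := fun f hf =>
    if_neg (by rw [hF f hf]; omega)
  have hq0 := invCard_nonneg (C := C)
  have hmain := norm_expect_prod_sub_exp_le (C := C) hG2 hζ (hmean.trans_le hΛ)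
    (by positivity) (meanCount_lastAt_le hG2 hGs hε (hmean.trans_le hΛ) ho) le_rfl
  rw [hov] at hmain
  refine le_trans (le_of_eq ?_) hmain
  congr 2
  · refine expect_congr rfl fun x _ => ?_
    rw [cexp_mul_sum_monoInd, cexp_mul_sum_monoInd, hG, prod_disjUnion]
    congr 1
    · exact prod_congr rfl fun e he => by rw [hζE e he]
    · exact prod_congr rfl fun e he => by rw [hζF e he]
  · congr 1
    rw [hG, sum_disjUnion, meanCount, meanCount]
    push_cast
    rw [mul_sum, mul_sum]
    congr 1
    · exact sum_congr rfl fun e he => by rw [hζE e he]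
    · exact sum_congr rfl fun e he => by rw [hζF e he]

variable {V C : ℕ → Type*} [∀ n, DecidableEq (V n)] [∀ n, Fintype (V n)] [∀ n, Fintype (C n)]

/-- If mean and variance have the same limit, then the overlap vanishes. -/
lemma tendsto_overlap_zero {E : ∀ n, Finset (Finset (V n))} (hE : ∀ n, ∀ e ∈ E n, 2 ≤ e.card)
    (hne : ∀ᶠ n in atTop, Nonempty (C n)) (hq : Tendsto (fun n => invCard (C n)) atTop (nhds 0))
    {l : ℝ} (hm : Tendsto (fun n => meanCount (C n) (E n)) atTop (nhds l))
    (hv : Tendsto (fun n => 𝔼 x : V n → C n, (∑ e ∈ E n, monoInd e x) ^ 2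
      - meanCount (C n) (E n) ^ 2) atTop (nhds l)) :
    Tendsto (fun n => overlap (C n) (E n) (E n)) atTop (nhds 0) := by
  have hlim : Tendsto (fun n => 2 * (𝔼 x : V n → C n, (∑ e ∈ E n, monoInd e x) ^ 2
      - meanCount (C n) (E n) ^ 2 - meanCount (C n) (E n)
      + invCard (C n) * meanCount (C n) (E n))) atTop (nhds 0) := by
    simpa using ((hv.sub hm).add (hq.mul hm)).const_mul 2
  refine tendsto_of_tendsto_of_tendsto_of_le_of_le' tendsto_const_nhds hlim
    (Eventually.of_forall fun n => overlap_nonneg _ _) ?_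
  filter_upwards [hne, hq.eventually_le_const (by norm_num : (0 : ℝ) < 1 / 2)] with n hn hqn
  have h1 := overlap_le_variance_sub_mean (C := C n) (hE n)
  have h2 := overlap_nonneg (C := C n) (E n) (E n)
  nlinarith

/-- Convergence of the joint characteristic functions of the two layers. -/
lemma tendsto_expect_cexp {r s : ℕ} (hr : 2 ≤ r) (hrs : r < s)
    {E F : ∀ n, Finset (Finset (V n))} (hE : ∀ n, ∀ e ∈ E n, e.card = r)
    (hF : ∀ n, ∀ f ∈ F n, f.card = s) (hne : ∀ᶠ n in atTop, Nonempty (C n))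
    (hq : Tendsto (fun n => invCard (C n)) atTop (nhds 0)) {l₁ l₂ : ℝ}
    (hmE : Tendsto (fun n => meanCount (C n) (E n)) atTop (nhds l₁))
    (hvE : Tendsto (fun n => 𝔼 x : V n → C n, (∑ e ∈ E n, monoInd e x) ^ 2
      - meanCount (C n) (E n) ^ 2) atTop (nhds l₁))
    (hmF : Tendsto (fun n => meanCount (C n) (F n)) atTop (nhds l₂))
    (hvF : Tendsto (fun n => 𝔼 x : V n → C n, (∑ f ∈ F n, monoInd f x) ^ 2
      - meanCount (C n) (F n) ^ 2) atTop (nhds l₂)) (t u : ℝ) :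
    Tendsto (fun n => 𝔼 x : V n → C n, Complex.exp (t * (∑ e ∈ E n, monoInd e x : ℝ) * Complex.I)
        * Complex.exp (u * (∑ f ∈ F n, monoInd f x : ℝ) * Complex.I)) atTop
      (nhds (Complex.exp ((Complex.exp (t * Complex.I) - 1) * l₁
          + (Complex.exp (u * Complex.I) - 1) * l₂))) := by
  have hQE := tendsto_overlap_zero (fun n e he => hr.trans_eq (hE n e he).symm) hne hq hmE hvE
  have hQF := tendsto_overlap_zero
    (fun n f hf => (hr.trans hrs.le).trans_eq (hF n f hf).symm) hne hq hmF hvF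
  have hQEF : Tendsto (fun n => overlap (C n) (E n) (F n)) atTop (nhds 0) := by
    have h1 : Tendsto (fun n => √((2 ^ r * (overlap (C n) (E n) (E n) + meanCount (C n) (E n)))
        * (2 ^ s * (overlap (C n) (F n) (F n) + invCard (C n) * meanCount (C n) (F n)))))
        atTop (nhds 0) := by
      have := (((hQE.add hmE).const_mul (2 ^ r : ℝ)).mul
        ((hQF.add (hq.mul hmF)).const_mul (2 ^ s : ℝ))).sqrt
      simpa using this
    refine tendsto_of_tendsto_of_tendsto_of_le_of_le' tendsto_const_nhds h1
      (Eventually.of_forall fun n => overlap_nonneg _ _) ?_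
    filter_upwards [hne] with n hn
    exact Real.le_sqrt_of_sq_le (overlap_sq_le hrs (hE n) (hF n))
  have hexp : Tendsto (fun n => Complex.exp ((Complex.exp (t * Complex.I) - 1)
        * meanCount (C n) (E n) + (Complex.exp (u * Complex.I) - 1) * meanCount (C n) (F n))) atTop
      (nhds (Complex.exp ((Complex.exp (t * Complex.I) - 1) * l₁
          + (Complex.exp (u * Complex.I) - 1) * l₂))) := by
    have hE' := (Complex.continuous_ofReal.tendsto _).comp hmE
    have hF' := (Complex.continuous_ofReal.tendsto _).comp hmF
    exact (Complex.continuous_exp.tendsto _).comp ((hE'.const_mul _).add (hF'.const_mul _))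
  set Λ : ℝ := l₁ + l₂ + 1 with hΛ
  have hbound : ∀ᶠ n in atTop, meanCount (C n) (E n) + meanCount (C n) (F n) ≤ Λ :=
    (hmE.add hmF).eventually_le_const (by linarith)
  have hdiff := (tendsto_zero_iff_norm_tendsto_zero (f := fun n =>
    (𝔼 x : V n → C n, Complex.exp (t * (∑ e ∈ E n, monoInd e x : ℝ) * Complex.I)
        * Complex.exp (u * (∑ f ∈ F n, monoInd f x : ℝ) * Complex.I))
      - Complex.exp ((Complex.exp (t * Complex.I) - 1) * meanCount (C n) (E n)
        + (Complex.exp (u * Complex.I) - 1) * meanCount (C n) (F n))) (a := atTop)).2 ?_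
  · simpa using hdiff.add hexp
  have hlim0 : Tendsto (fun ε : ℝ => Real.exp (8 * (Λ + 1)) * (8 * (ε * Λ) + 4 * √(ε * Λ)))
      (nhdsWithin 0 (Set.Ioi 0)) (nhds 0) := by
    have hc : Continuous fun ε : ℝ => Real.exp (8 * (Λ + 1)) * (8 * (ε * Λ) + 4 * √(ε * Λ)) := by
      fun_prop
    have := hc.tendsto 0
    simp only [zero_mul, mul_zero, Real.sqrt_zero, add_zero] at this
    exact this.mono_left nhdsWithin_le_nhds
  refine tendsto_order.2 ⟨fun a ha => Eventually.of_forall fun n => ha.trans_le (norm_nonneg _),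
    fun η hη => ?_⟩
  obtain ⟨ε, hεη, hε⟩ := ((hlim0.eventually_lt_const hη).and self_mem_nhdsWithin).exists
  have hδ : Tendsto (fun n => overlap (C n) (E n) (E n) + overlap (C n) (F n) (F n)
      + 2 * overlap (C n) (E n) (F n) + invCard (C n) * Λ
      + (ε + 2 ^ ⌊s * Λ / ε⌋₊ * invCard (C n)) * Λ) atTop (nhds (ε * Λ)) := by
    have := (((hQE.add hQF).add (hQEF.const_mul 2)).add (hq.mul_const Λ)).add
      (((hq.const_mul (2 ^ ⌊s * Λ / ε⌋₊)).const_add ε).mul_const Λ)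
    simpa using this
  have hB := ((hδ.const_mul 8).add (hδ.sqrt.const_mul 4)).const_mul (Real.exp (8 * (Λ + 1)))
  filter_upwards [hne, hbound, hB.eventually_lt_const hεη] with n hn hbn hBn
  exact (norm_expect_cexp_sub_exp_le hr hrs (hE n) (hF n) t u hε hbn).trans_lt hBn

end TwoLayers

section Probability

open Finset
open scoped BigOperators

/-- The hyperedges of `H` as a finite set of finite sets. -/
noncomputable def edgeFinset {V : Type*} [Finite V] (H : Hypergraph V) : Finset (Finset V) :=
  (Set.toFinite {e : Finset V | (e : Set V) ∈ H.edgeSet}).toFinset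

lemma mem_edgeFinset {V : Type*} [Finite V] {H : Hypergraph V} {e : Finset V} :
    e ∈ edgeFinset H ↔ (e : Set V) ∈ H.edgeSet := by
  simp [edgeFinset]

lemma card_eq_of_mem_edgeFinset {V : Type*} [Finite V] {H : Hypergraph V} {r : ℕ}
    (hH : H.IsUniform r) {e : Finset V} (he : e ∈ edgeFinset H) : e.card = r := by
  have := hH e (mem_edgeFinset.1 he)
  rw [Set.encard_coe_eq_coe_finsetCard] at this
  exact_mod_cast this

lemma monoCount_eq_sum {V C : Type*} [Finite V] (H : Hypergraph V) (x : V → C) :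
    (H.monoCount x : ℝ) = ∑ e ∈ edgeFinset H, monoInd e x := by
  classical
  have h : {e | e ∈ H.edgeSet ∧ IsMonochromatic x e}
      = (fun e : Finset V => (e : Set V)) ''
        ((edgeFinset H).filter fun e => IsMonochromatic x (e : Set V) : Finset (Finset V)) := by
    ext e
    simp only [Set.mem_ofPred_eq, Set.mem_image, mem_coe, mem_filter, mem_edgeFinset]
    constructor
    · rintro ⟨he, hm⟩
      exact ⟨(Set.toFinite e).toFinset, by simpa using ⟨he, hm⟩, by simp⟩
    · rintro ⟨f, hf, rfl⟩
      exact hf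
  rw [Hypergraph.monoCount, h, Set.ncard_image_of_injective _ Finset.coe_injective,
    Set.ncard_coe_finset, card_filter]
  push_cast
  refine sum_congr rfl fun e _ => ?_
  unfold monoInd
  congr 1

variable {V Ω : Type*} [MeasurableSpace Ω] {P : Measure Ω} {c : ℕ} {X : V → Ω → Fin c}

lemma measurable_coloring (hX : IsUniformColoring P c X) : Measurable fun ω v => X v ω :=
  measurable_pi_lambda _ hX.measurable

lemma measurable_comp_coloring [Finite V] (hX : IsUniformColoring P c X) {M : Type*}
    [MeasurableSpace M] (g : (V → Fin c) → M) : Measurable fun ω => g fun v => X v ω :=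
  (measurable_of_countable g).comp (measurable_coloring hX)

/-- Expectations of functions of a uniformly random coloring are averages over all colorings. -/
lemma integral_coloring [Fintype V] [DecidableEq V] [IsProbabilityMeasure P]
    (hX : IsUniformColoring P c X) {𝕜 : Type*} [RCLike 𝕜] (g : (V → Fin c) → 𝕜) :
    ∫ ω, g (fun v => X v ω) ∂P = 𝔼 x, g x := by
  have hm := measurable_coloring hX
  have : IsProbabilityMeasure (P.map fun ω v => X v ω) :=
    Measure.isProbabilityMeasure_map hm.aemeasurable
  rw [← integral_map hm.aemeasurable (f := g) (measurable_of_countable g).aestronglyMeasurable,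
    integral_fintype (Integrable.of_finite), Fintype.expect_eq_sum_div_card, sum_div]
  refine sum_congr rfl fun x _ => ?_
  have hx : (P.map fun ω v => X v ω).real {x} = (1 / (c : ℝ)) ^ Fintype.card V := by
    rw [map_measureReal_apply hm (measurableSet_singleton x)]
    have h1 : (fun ω v => X v ω) ⁻¹' {x} = ⋂ v ∈ (univ : Finset V), X v ⁻¹' {x v} := by
      ext ω
      simp [funext_iff]
    rw [h1, measureReal_def,
      hX.indep.measure_inter_preimage_eq_mul univ fun v _ => measurableSet_singleton _,
      ENNReal.toReal_prod]
    have h2 : ∀ v, (P (X v ⁻¹' {x v})).toReal = 1 / (c : ℝ) := fun v => hX.uniform v (x v)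
    simp [h2]
  rw [hx, RCLike.real_smul_eq_coe_mul]
  simp [div_eq_inv_mul]

lemma integral_monoCount [Fintype V] [DecidableEq V] [IsProbabilityMeasure P] [NeZero c]
    (hX : IsUniformColoring P c X) {E : Finset (Finset V)} (hE : ∀ e ∈ E, 2 ≤ e.card) :
    ∫ ω, ∑ e ∈ E, monoInd e (fun v => X v ω) ∂P = meanCount (Fin c) E := by
  rw [integral_coloring hX fun x => ∑ e ∈ E, monoInd e x, expect_sum_monoInd hE]

lemma variance_monoCount [Fintype V] [DecidableEq V] [IsProbabilityMeasure P] [NeZero c]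
    (hX : IsUniformColoring P c X) {E : Finset (Finset V)} (hE : ∀ e ∈ E, 2 ≤ e.card) :
    variance (fun ω => ∑ e ∈ E, monoInd e fun v => X v ω) P
      = 𝔼 x : V → Fin c, (∑ e ∈ E, monoInd e x) ^ 2 - meanCount (Fin c) E ^ 2 := by
  rw [variance_eq_integral
    (measurable_comp_coloring hX fun x => ∑ e ∈ E, monoInd e x).aemeasurable,
    integral_monoCount hX hE,
    integral_coloring hX fun x => (∑ e ∈ E, monoInd e x - meanCount (Fin c) E) ^ 2]
  have h : ∀ x : V → Fin c, (∑ e ∈ E, monoInd e x - meanCount (Fin c) E) ^ 2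
      = (∑ e ∈ E, monoInd e x) ^ 2 - 2 * meanCount (Fin c) E * ∑ e ∈ E, monoInd e x
        + meanCount (Fin c) E ^ 2 := fun x => by ring
  simp_rw [h]
  rw [expect_add_distrib, expect_sub_distrib, ← mul_expect, expect_sum_monoInd hE,
    Fintype.expect_const]
  ring

end Probability

/-- Convergence in distribution of pairs of real random variables from convergence of the joint
characteristic functions. -/
lemma tendstoInDistribution_prodMk_of_charFun {Ω : ℕ → Type*} [∀ n, MeasurableSpace (Ω n)]
    {P : ∀ n, Measure (Ω n)} [∀ n, IsProbabilityMeasure (P n)] {Ω' : Type*} [MeasurableSpace Ω']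
    {P' : Measure Ω'} [IsProbabilityMeasure P'] {S T : ∀ n, Ω n → ℝ} {Y Z : Ω' → ℝ}
    (hS : ∀ n, AEMeasurable (S n) (P n)) (hT : ∀ n, AEMeasurable (T n) (P n))
    (hY : AEMeasurable Y P') (hZ : AEMeasurable Z P')
    (h : ∀ t : WithLp 2 (ℝ × ℝ), Tendsto
      (fun n => charFun ((P n).map fun ω => WithLp.toLp 2 (S n ω, T n ω)) t) atTop
      (nhds (charFun (P'.map fun ω => WithLp.toLp 2 (Y ω, Z ω)) t))) :
    TendstoInDistribution (fun n ω => (S n ω, T n ω)) atTop (fun ω => (Y ω, Z ω)) P P' := by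
  have h1 : TendstoInDistribution (fun n ω => WithLp.toLp 2 (S n ω, T n ω)) atTop
      (fun ω => WithLp.toLp 2 (Y ω, Z ω)) P P' :=
    { forall_aemeasurable := fun n => by have := hS n; have := hT n; fun_prop
      aemeasurable_limit := by fun_prop
      tendsto := ProbabilityMeasure.tendsto_iff_tendsto_charFun.2 fun t => h t }
  exact h1.continuous_comp (g := WithLp.ofLp) (WithLp.prod_continuous_ofLp 2 ℝ ℝ)

lemma charFun_map_toLp_prodMk {Ω : Type*} [MeasurableSpace Ω] {P : Measure Ω} {S T : Ω → ℝ}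
    (hS : AEMeasurable S P) (hT : AEMeasurable T P) (t : WithLp 2 (ℝ × ℝ)) :
    charFun (P.map fun ω => WithLp.toLp 2 (S ω, T ω)) t
      = ∫ ω, Complex.exp (t.fst * S ω * Complex.I) * Complex.exp (t.snd * T ω * Complex.I) ∂P := by
  rw [charFun_apply, integral_map (by fun_prop) (by fun_prop)]
  refine integral_congr_ae (Eventually.of_forall fun ω => ?_)
  simp only [WithLp.prod_inner_apply]
  rw [← Complex.exp_add]
  congr 1
  simp
  ring

end HypergraphColoring

open HypergraphColoring in
/-- Joint Poisson convergence of the numbers of monochromatic hyperedges in two layers of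
different uniformities `2 ≤ r₁ < r₂` on a common vertex set. -/
theorem theorem1p3
    (r₁ r₂ : ℕ) (hr₁ : 2 ≤ r₁) (hr : r₁ < r₂)
    -- the common finite vertex sets and the two layers
    (V : ℕ → Type*) [∀ n, Finite (V n)]
    (H₁ H₂ : ∀ n, Hypergraph (V n))
    (hV₁ : ∀ n, (H₁ n).vertexSet = Set.univ) (hV₂ : ∀ n, (H₂ n).vertexSet = Set.univ)
    (hH₁ : ∀ n, (H₁ n).IsUniform r₁) (hH₂ : ∀ n, (H₂ n).IsUniform r₂)
    -- the numbers of colors and the uniformly random colorings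
    (c : ℕ → ℕ) (hc : Tendsto c atTop atTop)
    (Ω : ℕ → Type*) [∀ n, MeasurableSpace (Ω n)]
    (P : ∀ n, Measure (Ω n)) [∀ n, IsProbabilityMeasure (P n)]
    (X : ∀ n, V n → Ω n → Fin (c n)) (hX : ∀ n, IsUniformColoring (P n) (c n) (X n))
    -- the numbers of monochromatic hyperedges in the two layers
    (T₁ T₂ : ∀ n, Ω n → ℝ)
    (hT₁ : ∀ n ω, T₁ n ω = ((H₁ n).monoCount (fun v => X n v ω) : ℝ))
    (hT₂ : ∀ n ω, T₂ n ω = ((H₂ n).monoCount (fun v => X n v ω) : ℝ))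
    -- convergence of the means and variances
    (lam₁ lam₂ : ℝ≥0)
    (hE₁ : Tendsto (fun n => ∫ ω, T₁ n ω ∂(P n)) atTop (nhds (lam₁ : ℝ)))
    (hVar₁ : Tendsto (fun n => variance (T₁ n) (P n)) atTop (nhds (lam₁ : ℝ)))
    (hE₂ : Tendsto (fun n => ∫ ω, T₂ n ω ∂(P n)) atTop (nhds (lam₂ : ℝ)))
    (hVar₂ : Tendsto (fun n => variance (T₂ n) (P n)) atTop (nhds (lam₂ : ℝ)))
    -- the limit: a pair of independent Poisson random variables on any probability space
    {Ω' : Type*} [MeasurableSpace Ω'] (P' : Measure Ω') [IsProbabilityMeasure P']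
    (Z₁ Z₂ : Ω' → ℕ)
    (hZ₁ : HasLaw Z₁ (poissonMeasure lam₁) P') (hZ₂ : HasLaw Z₂ (poissonMeasure lam₂) P')
    (hZ : IndepFun Z₁ Z₂ P') :
    TendstoInDistribution (fun n ω => (T₁ n ω, T₂ n ω)) atTop
      (fun ω => ((Z₁ ω : ℝ), (Z₂ ω : ℝ))) P P' := by
  classical
  have hfin : ∀ n, Fintype (V n) := fun n => Fintype.ofFinite _
  have hT₁' : T₁ = fun n ω => ∑ e ∈ edgeFinset (H₁ n), monoInd e fun v => X n v ω := by
    funext n ω; rw [hT₁, monoCount_eq_sum]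
  have hT₂' : T₂ = fun n ω => ∑ e ∈ edgeFinset (H₂ n), monoInd e fun v => X n v ω := by
    funext n ω; rw [hT₂, monoCount_eq_sum]
  subst hT₁' hT₂'
  have hcard₁ : ∀ n, ∀ e ∈ edgeFinset (H₁ n), e.card = r₁ := fun n e he =>
    card_eq_of_mem_edgeFinset (hH₁ n) he
  have hcard₂ : ∀ n, ∀ e ∈ edgeFinset (H₂ n), e.card = r₂ := fun n e he =>
    card_eq_of_mem_edgeFinset (hH₂ n) he
  have htwo₁ : ∀ n, ∀ e ∈ edgeFinset (H₁ n), 2 ≤ e.card := fun n e he => by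
    rw [hcard₁ n e he]; exact hr₁
  have htwo₂ : ∀ n, ∀ e ∈ edgeFinset (H₂ n), 2 ≤ e.card := fun n e he => by
    rw [hcard₂ n e he]; omega
  have hpos : ∀ᶠ n in atTop, NeZero (c n) :=
    (hc.eventually_gt_atTop 0).mono fun n hn => ⟨hn.ne'⟩
  have hne : ∀ᶠ n in atTop, Nonempty (Fin (c n)) := hpos.mono fun n _ => ⟨0⟩
  have hq : Tendsto (fun n => invCard (Fin (c n))) atTop (nhds 0) := by
    simpa [invCard] using! tendsto_inv_atTop_zero.comp (tendsto_natCast_atTop_atTop.comp hc)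
  have hmE := hE₁.congr' (hpos.mono fun n _ => integral_monoCount (hX n) (htwo₁ n))
  have hmF := hE₂.congr' (hpos.mono fun n _ => integral_monoCount (hX n) (htwo₂ n))
  have hvE := hVar₁.congr' (hpos.mono fun n _ => variance_monoCount (hX n) (htwo₁ n))
  have hvF := hVar₂.congr' (hpos.mono fun n _ => variance_monoCount (hX n) (htwo₂ n))
  have hmeas : ∀ n (E : Finset (Finset (V n))), AEMeasurable
      (fun ω => ∑ e ∈ E, monoInd e fun v => X n v ω) (P n) := fun n E =>
    (measurable_comp_coloring (hX n) fun x => ∑ e ∈ E, monoInd e x).aemeasurable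
  have hcast : Measurable (fun k : ℕ => (k : ℝ)) := measurable_of_countable _
  have hZm₁ : AEMeasurable (fun ω => (Z₁ ω : ℝ)) P' := hcast.comp_aemeasurable hZ₁.aemeasurable
  have hZm₂ : AEMeasurable (fun ω => (Z₂ ω : ℝ)) P' := hcast.comp_aemeasurable hZ₂.aemeasurable
  have hlaw₁ : P'.map (fun ω => (Z₁ ω : ℝ)) = (poissonMeasure lam₁).map (fun k : ℕ => (k : ℝ)) := by
    rw [← hZ₁.map_eq, AEMeasurable.map_map_of_aemeasurable hcast.aemeasurable hZ₁.aemeasurable]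
    rfl
  have hlaw₂ : P'.map (fun ω => (Z₂ ω : ℝ)) = (poissonMeasure lam₂).map (fun k : ℕ => (k : ℝ)) := by
    rw [← hZ₂.map_eq, AEMeasurable.map_map_of_aemeasurable hcast.aemeasurable hZ₂.aemeasurable]
    rfl
  refine tendstoInDistribution_prodMk_of_charFun (fun n => hmeas n _) (fun n => hmeas n _)
    hZm₁ hZm₂ fun t => ?_
  rw [(indepFun_iff_charFun_prod hZm₁ hZm₂).1 (hZ.comp hcast hcast) t, hlaw₁, hlaw₂,
    charFun_map_cast_poissonMeasure, charFun_map_cast_poissonMeasure, ← Complex.exp_add]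
  have hlim := tendsto_expect_cexp hr₁ hr hcard₁ hcard₂ hne hq hmE hvE hmF hvF t.fst t.snd
  have hval : (lam₁ : ℂ) * (Complex.exp (t.ofLp.1 * Complex.I) - 1)
        + (lam₂ : ℂ) * (Complex.exp (t.ofLp.2 * Complex.I) - 1)
      = (Complex.exp (t.fst * Complex.I) - 1) * ((lam₁ : ℝ) : ℂ)
        + (Complex.exp (t.snd * Complex.I) - 1) * ((lam₂ : ℝ) : ℂ) := by
    simp only [mul_comm]
    rfl
  rw [hval]
  refine hlim.congr fun n => ?_
  rw [charFun_map_toLp_prodMk (hmeas n _) (hmeas n _)]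
  exact (integral_coloring (hX n) fun x =>
    Complex.exp (t.fst * (∑ e ∈ edgeFinset (H₁ n), monoInd e x : ℝ) * Complex.I)
      * Complex.exp (t.snd * (∑ f ∈ edgeFinset (H₂ n), monoInd f x : ℝ) * Complex.I)).symm
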